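/- Let $\Omega\subset\mathbb R^n$ be compact, let $\delta>0$, and write $\mathcal M^+(Z)$ and $\mathcal M(Z)$ for the finite positive and the finite signed Borel measures on $Z$. Let $\rho_0,\rho_1\in\mathcal M^+(\Omega)$. Let $\mathcal{CE}(\rho_0,\rho_1)$ be the set of triples $\mu=(\rho,\omega,\zeta)\in\mathcal M^+([0,1]\times\Omega)\times\mathcal M([0,1]\times\Omega)^n\times\mathcal M([0,1]\times\Omega)$ such that $$\int_{[0,1]\times\Omega}\partial_t\phi\,d\rho+\int_{[0,1]\times\Omega}\nabla\phi\cdot d\omega+\int_{[0,1]\times\Omega}\phi\,d\zeta=\int_\Omega\phi(1,\cdot)\,d\rho_1-\int_\Omega\phi(0,\cdot)\,d\rho_0$$ for every $\phi\in C^1([0,1]\times\Omega)$ (restrictions of $C^1$ functions on $\mathbb R\times\mathbb R^n$, with their derivatives). The WFR energy of $\mu$ is $E_\delta(\mu)=\int_{[0,1]\times\Omega} f_\delta\big(\tfrac{d\rho}{d\lambda},\tfrac{d\omega}{d\lambda},\tfrac{d\zeta}{d\lambda}\big)\,d\lambda\in[0,\infty]$, where $f_\delta(r,w,z)=\frac{\|w\|^2+\delta^2z^2}{2r}$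 if $r>0$, $f_\delta(0,0,0)=0$, $f_\delta=+\infty$ otherwise, and $\lambda$ is any positive $\sigma$-finite measure with $\rho,\omega,\zeta\ll\lambda$ (the value does not depend on $\lambda$). Let $0\le d'\le d$ be integers and let $H=(H_i)_{i=1}^d$, $H_i=(H_i^\rho,H_i^\omega,H_i^\zeta):[0,1]\times\Omega\to\mathbb R\times\mathbb R^n\times\mathbb R$, and $F=(F_i)_{i=1}^d$, $F_i:[0,1]\to\mathbb R$, be continuous. Let $\mathcal{CE}_{H,F}(\rho_0,\rho_1)$ be the set of $\mu\in\mathcal{CE}(\rho_0,\rho_1)$ such that, for each $i=1,\dots,d$, the measures disintegrate in time as $\rho=dt\otimes\rho_t$, $\omega=dt\otimes\omega_t$, $\zeta=dt\otimes\zeta_t$ with Borel families of finite (signed) measures on $\Omega$, and for a.e. $t\in[0,1]$ $$\int_\Omega H_i^\rho(t,x)\,d\rho_t(x)+\int_\Omega H_i^\omega(t,x)\cdot d\omega_t(x)+\int_\Omega H_i^\zeta(t,x)\,d\zeta_t(x)\;\begin{cases}\le F_i(t), & 1\le i\le d',\\ =F_i(t), & d'<i\le d.\end{cases}$$ If there is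 $\mu\in\mathcal{CE}_{H,F}(\rho_0,\rho_1)$ with $E_\delta(\mu)<\infty$, then there is $\mu^*\in\mathcal{CE}_{H,F}(\rho_0,\rho_1)$ with $$E_\delta(\mu^*)=\inf\{E_\delta(\mu)\mid\mu\in\mathcal{CE}_{H,F}(\rho_0,\rho_1)\}.$$ -/

import Mathlib

open MeasureTheory
open scoped unitInterval ENNReal

noncomputable section

namespace ConstrainedWFR

/-- A triple `(ρ, ω, ζ) ∈ M⁺([0,1] × Ω) × M([0,1] × Ω)ⁿ × M([0,1] × Ω)`: density, momentum and
source. Finite Borel measures on the product, no absolute continuity in time required. -/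
structure MeasTriple (n : ℕ) (Ω : Set (EuclideanSpace ℝ (Fin n))) where
  rho : FiniteMeasure (I × Ω)
  omega : Fin n → SignedMeasure (I × Ω)
  zeta : SignedMeasure (I × Ω)

variable {n : ℕ} {Ω : Set (EuclideanSpace ℝ (Fin n))}

/-- The integral `∫ f dm` of a real function against a signed measure. -/
def sint {X : Type*} [MeasurableSpace X] (m : SignedMeasure X) (f : X → ℝ) : ℝ :=
  VectorMeasure.integral m f (ContinuousLinearMap.lsmul ℝ ℝ)

/-- The set `CE(ρ₀, ρ₁)`: the continuity equation `∂ₜρ + ∇·ω = ζ` in the distributional sense with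
boundary values `ρ₀`, `ρ₁`. Elements of `C¹([0,1] × Ω)` are given by `C¹` functions on
`ℝ × ℝⁿ`, restricted to `[0,1] × Ω`. -/
def CE (ρ₀ ρ₁ : FiniteMeasure Ω) : Set (MeasTriple n Ω) :=
  {μ | ∀ φ : ℝ × EuclideanSpace ℝ (Fin n) → ℝ, ContDiff ℝ 1 φ →
    (∫ p : I × Ω, deriv (fun s : ℝ => φ (s, p.2)) p.1 ∂(μ.rho : Measure (I × Ω)))
      + (∑ j, sint (μ.omega j)
          (fun p => gradient (fun y : EuclideanSpace ℝ (Fin n) => φ (p.1, y)) p.2 j))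
      + sint μ.zeta (fun p => φ (p.1, p.2))
    = (∫ x : Ω, φ (1, x) ∂(ρ₁ : Measure Ω)) - ∫ x : Ω, φ (0, x) ∂(ρ₀ : Measure Ω)}

/-- The Wasserstein-Fisher-Rao infinitesimal cost `f_δ`. -/
def infCost (δ r : ℝ) (w : EuclideanSpace ℝ (Fin n)) (z : ℝ) : ℝ≥0∞ :=
  open Classical in
  if 0 < r then ENNReal.ofReal ((‖w‖ ^ 2 + δ ^ 2 * z ^ 2) / (2 * r))
  else if r = 0 ∧ w = 0 ∧ z = 0 then 0 else ⊤

/-- `∫ f_δ(dμ/dlam) dlam` for a reference measure `lam`. -/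
def costWrt (δ : ℝ) (μ : MeasTriple n Ω) (lam : Measure (I × Ω)) : ℝ≥0∞ :=
  ∫⁻ p, infCost δ ((μ.rho : Measure (I × Ω)).rnDeriv lam p).toReal
    (WithLp.toLp 2 fun j => (μ.omega j).rnDeriv lam p) (μ.zeta.rnDeriv lam p) ∂lam

/-- A finite measure that dominates `ρ`, all components of `ω`, and `ζ`. -/
def MeasTriple.ref (μ : MeasTriple n Ω) : Measure (I × Ω) :=
  (μ.rho : Measure (I × Ω)) + (∑ j, (μ.omega j).totalVariation) + μ.zeta.totalVariation

/-- The WFR energy of `μ`. By `costWrt_eq_energy` below, any other σ-finite reference measure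
dominating `μ` gives the same value. -/
def energy (δ : ℝ) (μ : MeasTriple n Ω) : ℝ≥0∞ := costWrt δ μ μ.ref

/-- `ρ = dt ⊗ ρ_t` for a Borel family of finite positive measures `ρ_t` on `Ω`. -/
structure IsDisintegration (ρ : FiniteMeasure (I × Ω)) (r : I → FiniteMeasure Ω) : Prop where
  measurable : ∀ B : Set Ω, MeasurableSet B → Measurable fun t => (r t : Measure Ω) B
  apply_prod : ∀ (A : Set I) (B : Set Ω), MeasurableSet A → MeasurableSet B →
    (ρ : Measure (I × Ω)) (A ×ˢ B) = ∫⁻ t in A, (r t : Measure Ω) B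

/-- `m = dt ⊗ m_t` for a Borel family of signed measures `m_t` on `Ω`. -/
structure IsSignedDisintegration (m : SignedMeasure (I × Ω)) (s : I → SignedMeasure Ω) :
    Prop where
  measurable : ∀ B : Set Ω, MeasurableSet B → Measurable fun t => s t B
  integrable : ∀ B : Set Ω, MeasurableSet B → Integrable fun t => s t B
  apply_prod : ∀ (A : Set I) (B : Set Ω), MeasurableSet A → MeasurableSet B →
    m (A ×ˢ B) = ∫ t in A, s t B

/-- `∫ h^ρ(t,·) dρ_t + ∫ h^ω(t,·)·dω_t + ∫ h^ζ(t,·) dζ_t` at a fixed time `t`, for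
`h = (h^ρ, h^ω, h^ζ)`. -/
def sliceFunctional (h : I × Ω → ℝ × EuclideanSpace ℝ (Fin n) × ℝ) (t : I)
    (r : FiniteMeasure Ω) (w : Fin n → SignedMeasure Ω) (z : SignedMeasure Ω) : ℝ :=
  (∫ x : Ω, (h (t, x)).1 ∂(r : Measure Ω))
    + (∑ j, sint (w j) fun x => (h (t, x)).2.1 j)
    + sint z fun x => (h (t, x)).2.2

/-- `μ` disintegrates in time and, for a.e. `t`, the slice functional stands in relation `R` to
`F t`. -/
def Aff (R : ℝ → ℝ → Prop) (h : I × Ω → ℝ × EuclideanSpace ℝ (Fin n) × ℝ) (F : I → ℝ) :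
    Set (MeasTriple n Ω) :=
  {μ | ∃ (r : I → FiniteMeasure Ω) (w : I → Fin n → SignedMeasure Ω) (z : I → SignedMeasure Ω),
    IsDisintegration μ.rho r ∧
    (∀ j, IsSignedDisintegration (μ.omega j) fun t => w t j) ∧
    IsSignedDisintegration μ.zeta z ∧
    ∀ᵐ t : I, R (sliceFunctional h t (r t) (w t) (z t)) (F t)}

/-- The affine equality constraint space. -/
def AffEq (h : I × Ω → ℝ × EuclideanSpace ℝ (Fin n) × ℝ) (F : I → ℝ) : Set (MeasTriple n Ω) :=
  Aff (fun a b => a = b) h F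

/-- The affine inequality constraint space. -/
def AffIneq (h : I × Ω → ℝ × EuclideanSpace ℝ (Fin n) × ℝ) (F : I → ℝ) :
    Set (MeasTriple n Ω) :=
  Aff (fun a b => a ≤ b) h F

/-- The constrained paths: the first `d'` constraints are inequalities, the remaining `d - d'`
are equalities. -/
def constrainedPaths {d : ℕ} (d' : ℕ) (H : I × Ω → Fin d → ℝ × EuclideanSpace ℝ (Fin n) × ℝ)
    (F : I → Fin d → ℝ) (ρ₀ ρ₁ : FiniteMeasure Ω) : Set (MeasTriple n Ω) :=
  {μ | μ ∈ CE ρ₀ ρ₁ ∧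
    (∀ i : Fin d, (i : ℕ) < d' → μ ∈ AffIneq (fun p => H p i) (fun t => F t i)) ∧
    (∀ i : Fin d, d' ≤ (i : ℕ) → μ ∈ AffEq (fun p => H p i) (fun t => F t i))}

/-- The optimal value `WFR_δ^{H,F}(ρ₀, ρ₁)²`. -/
def wfrSq {d : ℕ} (δ : ℝ) (d' : ℕ) (H : I × Ω → Fin d → ℝ × EuclideanSpace ℝ (Fin n) × ℝ)
    (F : I → Fin d → ℝ) (ρ₀ ρ₁ : FiniteMeasure Ω) : ℝ≥0∞ :=
  ⨅ μ ∈ constrainedPaths d' H F ρ₀ ρ₁, energy δ μ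

/-! Independence of the energy from the reference measure. -/

theorem infCost_smul (δ : ℝ) {c : ℝ} (hc : 0 ≤ c) (r : ℝ) (w : EuclideanSpace ℝ (Fin n)) (z : ℝ) :
    infCost δ (r * c) (WithLp.toLp 2 fun j => w j * c) (z * c)
      = ENNReal.ofReal c * infCost δ r w z := by
  have hw : (WithLp.toLp 2 fun j => w j * c : EuclideanSpace ℝ (Fin n)) = c • w := by
    ext j; simp [mul_comm]
  rw [hw]
  rcases hc.eq_or_lt with rfl | hc
  · simp [infCost]
  unfold infCost
  by_cases hr : 0 < r
  · rw [if_pos (by positivity), if_pos hr, ← ENNReal.ofReal_mul hc.le, norm_smul,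
      Real.norm_of_nonneg hc.le]
    congr 1
    field_simp
  · have : ¬ 0 < r * c := by
      intro h; exact hr (pos_of_mul_pos_left h hc.le)
    rw [if_neg this, if_neg hr]
    by_cases h : r = 0 ∧ w = 0 ∧ z = 0
    · rw [if_pos h, if_pos (by simp [h])]; simp
    · rw [if_neg h, if_neg (by simpa [hc.ne'] using h), ENNReal.mul_top (by simpa using hc)]

theorem signed_rnDeriv_mul {X : Type*} [MeasurableSpace X] (m : SignedMeasure X)
    (ν lam : Measure X) [SigmaFinite ν] [SigmaFinite lam] (h : m.totalVariation ≪ ν) :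
    ∀ᵐ p ∂lam, m.rnDeriv lam p = m.rnDeriv ν p * (ν.rnDeriv lam p).toReal := by
  have hp : m.toJordanDecomposition.posPart ≪ ν :=
    (Measure.absolutelyContinuous_of_le (Measure.le_add_right le_rfl)).trans h
  have hn : m.toJordanDecomposition.negPart ≪ ν :=
    (Measure.absolutelyContinuous_of_le (Measure.le_add_left le_rfl)).trans h
  filter_upwards [Measure.rnDeriv_mul_rnDeriv (κ := lam) hp,
    Measure.rnDeriv_mul_rnDeriv (κ := lam) hn] with p h1 h2
  simp only [SignedMeasure.rnDeriv, ← h1, ← h2, Pi.mul_apply, ENNReal.toReal_mul]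
  ring

theorem measurable_infCost (δ : ℝ) :
    Measurable fun q : ℝ × EuclideanSpace ℝ (Fin n) × ℝ => infCost δ q.1 q.2.1 q.2.2 := by
  unfold infCost
  refine Measurable.ite (measurableSet_lt measurable_const measurable_fst) ?_ ?_
  · fun_prop
  · refine Measurable.ite ?_ measurable_const measurable_const
    have : {q : ℝ × EuclideanSpace ℝ (Fin n) × ℝ | q.1 = 0 ∧ q.2.1 = 0 ∧ q.2.2 = 0} = {0} := by
      ext q; simp [Prod.ext_iff]
    rw [this]; exact measurableSet_singleton _

theorem costWrt_eq_energy (δ : ℝ) (μ : MeasTriple n Ω) (lam : Measure (I × Ω)) [SigmaFinite lam]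
    (hρ : (μ.rho : Measure (I × Ω)) ≪ lam) (hω : ∀ j, (μ.omega j).totalVariation ≪ lam)
    (hζ : μ.zeta.totalVariation ≪ lam) : costWrt δ μ lam = energy δ μ := by
  have hfin : ∀ m : SignedMeasure (I × Ω), IsFiniteMeasure m.totalVariation := fun m => by
    unfold SignedMeasure.totalVariation; infer_instance
  have : IsFiniteMeasure μ.ref := by unfold MeasTriple.ref; infer_instance
  have hsum : ∀ j, (μ.omega j).totalVariation ≤ ∑ j, (μ.omega j).totalVariation := fun j =>
    Finset.single_le_sum (f := fun j => (μ.omega j).totalVariation)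
      (fun _ _ => Measure.zero_le _) (Finset.mem_univ j)
  have hρr : (μ.rho : Measure (I × Ω)) ≪ μ.ref :=
    Measure.absolutelyContinuous_of_le (Measure.le_add_right (Measure.le_add_right le_rfl))
  have hωr : ∀ j, (μ.omega j).totalVariation ≪ μ.ref := fun j =>
    Measure.absolutelyContinuous_of_le (Measure.le_add_right (Measure.le_add_left (hsum j)))
  have hζr : μ.zeta.totalVariation ≪ μ.ref :=
    Measure.absolutelyContinuous_of_le (Measure.le_add_left le_rfl)
  have href : μ.ref ≪ lam := by
    intro A hA
    simp [MeasTriple.ref, hρ hA, hζ hA, fun j => hω j hA]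
  have hm : ∀ m : SignedMeasure (I × Ω), Measurable (m.rnDeriv μ.ref) := fun m =>
    SignedMeasure.measurable_rnDeriv m μ.ref
  unfold energy costWrt
  rw [← lintegral_rnDeriv_mul href]
  · refine lintegral_congr_ae ?_
    filter_upwards [Measure.rnDeriv_mul_rnDeriv (κ := lam) hρr,
      ae_all_iff.2 fun j => signed_rnDeriv_mul (μ.omega j) μ.ref lam (hωr j),
      signed_rnDeriv_mul μ.zeta μ.ref lam hζr, μ.ref.rnDeriv_lt_top lam] with p h1 h2 h3 h4
    simp only [h2, h3, ← h1, Pi.mul_apply, ENNReal.toReal_mul]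
    rw [infCost_smul δ ENNReal.toReal_nonneg _
      (WithLp.toLp 2 fun j => (μ.omega j).rnDeriv μ.ref p), ENNReal.ofReal_toReal h4.ne]
  · refine ((measurable_infCost δ).comp (f := fun p => (_, _, _)) ?_).aemeasurable
    refine (Measure.measurable_rnDeriv _ _).ennreal_toReal.prodMk (Measurable.prodMk ?_ (hm _))
    exact (WithLp.measurable_toLp 2 _).comp (measurable_pi_lambda _ fun j => hm _)

end ConstrainedWFR

end

/-! The proof is the direct method, in the variables density and velocity. Finite energy forces `ω`
and `ζ` to be absolutely continuous with respect to `ρ`, so a competitor is a pair `(ρ, u)` with `u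
= (v, δ g)` in `L²(ρ)`, and its energy is `½ ∫ ‖u‖² dρ` (`exists_velocity_of_energy_lt_top`,
`energy_ofVelocity`).

Testing the continuity equation with functions of time only bounds the total mass, and even the
density of the time marginal, in terms of the energy (`mass_le`, `integral_time_le_bound`). The
second bound is essential: it survives weak limits and prevents concentration in time, so the limit
still disintegrates against `dt`.

Once the time marginal is absolutely continuous, a constraint for a.e. `t` is equivalent to its
integrated form against continuous `ψ(t)`, with `ψ ≥ 0` in the case of inequalities
(`ofVelocity_mem_AffIneq_iff`, `ofVelocity_mem_AffEq_iff`). This form and the continuity equation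
pair `ρ` and `uρ` linearly with continuous functions, so both are closed under weak convergence.

Compactness and lower semicontinuity come together in `exists_weak_limit`. Along a minimizing
sequence `ρ_k` converges weakly to some `ρ'`, and the pairings `∫ b · u_k dρ_k` converge to a linear
functional `Λ(b)`. Young's inequality passes to the limit as `Λ(b) ≤ ½ ∫ ‖b‖² dρ' + m`, where `m` is
the infimum, and Riesz representation in `L²(ρ')` gives `u'` with energy at most `m`. -/

noncomputable section

namespace ConstrainedWFR

variable {n : ℕ} {Ω : Set (EuclideanSpace ℝ (Fin n))}

/-! ### Signed measures with a density -/

/-- Integration against a signed measure with density `v` is integration of the product. -/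
theorem sint_withDensityᵥ {X : Type*} [MeasurableSpace X] {ρ : Measure X} {v f : X → ℝ} {C : ℝ}
    (hv : Integrable v ρ) (hf : Measurable f) (hC : ∀ x, ‖f x‖ ≤ C) :
    sint (ρ.withDensityᵥ v) f = ∫ x, f x * v x ∂ρ := by
  have h1 := isFiniteMeasure_withDensity_ofReal hv.2
  have h2 := isFiniteMeasure_withDensity_ofReal hv.neg.2
  have hflip : (ContinuousLinearMap.lsmul ℝ ℝ : ℝ →L[ℝ] ℝ →L[ℝ] ℝ)
      = (ContinuousLinearMap.lsmul ℝ ℝ : ℝ →L[ℝ] ℝ →L[ℝ] ℝ).flip := by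
    ext; simp
  have hi : ∀ ν : Measure X, IsFiniteMeasure ν → Integrable f ν := fun ν _ =>
    Integrable.of_bound hf.aestronglyMeasurable C (ae_of_all _ hC)
  have hp : ∀ w : X → ℝ, Integrable w ρ → Integrable (fun x => f x * w x) ρ := fun w hw =>
    hw.bdd_mul (c := C) hf.aestronglyMeasurable (ae_of_all _ hC)
  have key : ∀ w : X → ℝ, Integrable w ρ →
      ∫ x, f x ∂(ρ.withDensity fun x => ENNReal.ofReal (w x)) = ∫ x, f x * max (w x) 0 ∂ρ := by
    intro w hw
    rw [integral_withDensity_eq_integral_toReal_smul₀ hw.1.aemeasurable.ennreal_ofReal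
      (ae_of_all _ fun _ => ENNReal.ofReal_lt_top)]
    refine integral_congr_ae (ae_of_all _ fun x => ?_)
    simp [ENNReal.toReal_ofReal', mul_comm]
  rw [sint, withDensityᵥ_eq_withDensity_pos_part_sub_withDensity_neg_part hv,
    VectorMeasure.integral_sub_vectorMeasure, hflip, VectorMeasure.integral_toSignedMeasure,
    VectorMeasure.integral_toSignedMeasure, key v hv, key (fun x => -v x) hv.neg, ← integral_sub]
  · refine integral_congr_ae (ae_of_all _ fun x => ?_)
    rcases le_total 0 (v x) with h | h <;> simp [h]
  · exact hp _ hv.pos_part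
  · exact hp _ hv.neg.pos_part
  · simpa [VectorMeasure.Integrable] using hi _ h1
  · simpa [VectorMeasure.Integrable] using hi _ h2

theorem totalVariation_withDensityᵥ_absolutelyContinuous {X : Type*} [MeasurableSpace X]
    (ρ : Measure X) (v : X → ℝ) :
    SignedMeasure.totalVariation (ρ.withDensityᵥ v) ≪ ρ := by
  have := (SignedMeasure.absolutelyContinuous_ennreal_iff _ _).1
    (Measure.withDensityᵥ_absolutelyContinuous ρ v)
  rwa [show ρ.toENNRealVectorMeasure.ennrealToMeasure = ρ from
    VectorMeasure.equivMeasure.right_inv ρ] at this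

theorem rnDeriv_withDensityᵥ {X : Type*} [MeasurableSpace X] (ρ : Measure X)
    {v : X → ℝ} (hv : Integrable v ρ) :
    SignedMeasure.rnDeriv (ρ.withDensityᵥ v) ρ =ᵐ[ρ] v :=
  (SignedMeasure.eq_rnDeriv 0 v hv (VectorMeasure.MutuallySingular.zero_left)
    (by simp)).symm

theorem withDensityᵥ_rnDeriv_of_absolutelyContinuous {X : Type*} [MeasurableSpace X]
    (s : SignedMeasure X) (ρ : Measure X) [SigmaFinite ρ] (h : s.totalVariation ≪ ρ) :
    ρ.withDensityᵥ (s.rnDeriv ρ) = s := by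
  refine s.withDensityᵥ_rnDeriv_eq ρ ((SignedMeasure.absolutelyContinuous_ennreal_iff _ _).2 ?_)
  rwa [show ρ.toENNRealVectorMeasure.ennrealToMeasure = ρ from
    VectorMeasure.equivMeasure.right_inv ρ]

/-- If `s ≪ lam` and the density of `s` vanishes wherever that of `ρ` does, then `s ≪ ρ`. -/
theorem totalVariation_absolutelyContinuous_of_rnDeriv {X : Type*} [MeasurableSpace X]
    (s : SignedMeasure X) (ρ lam : Measure X) [SigmaFinite ρ] [SigmaFinite lam]
    (hs : s.totalVariation ≪ lam) (hρ : ρ ≪ lam)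
    (h : ∀ᵐ p ∂lam, ρ.rnDeriv lam p = 0 → s.rnDeriv lam p = 0) : s.totalVariation ≪ ρ := by
  rw [show ρ = ρ.toENNRealVectorMeasure.ennrealToMeasure from
    (VectorMeasure.equivMeasure.right_inv ρ).symm, ← SignedMeasure.absolutelyContinuous_ennreal_iff]
  refine VectorMeasure.AbsolutelyContinuous.mk fun A hA hA0 => ?_
  rw [Measure.toENNRealVectorMeasure_apply_measurable hA] at hA0
  rw [← withDensityᵥ_rnDeriv_of_absolutelyContinuous s lam hs,
    withDensityᵥ_apply (SignedMeasure.integrable_rnDeriv _ _) hA]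
  refine integral_eq_zero_of_ae ?_
  have h0 : ∫⁻ p in A, ρ.rnDeriv lam p ∂lam = 0 := by
    rw [Measure.setLIntegral_rnDeriv hρ, hA0]
  rw [lintegral_eq_zero_iff (Measure.measurable_rnDeriv _ _)] at h0
  filter_upwards [h0, ae_restrict_of_ae h] with p h1 h2 using h2 h1

/-! ### Triples given by a density and a velocity -/

/-- Velocity–growth vectors: the coordinates `some j` form a velocity in `ℝⁿ`, the coordinate
`none` is the growth rate scaled by `δ`. -/
abbrev Vel (n : ℕ) : Type := EuclideanSpace ℝ (Option (Fin n))

/-- The triple `(ρ, vρ, gρ)` with `u = (v, δ g)`. -/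
def ofVelocity (δ : ℝ) (ρ : FiniteMeasure (I × Ω)) (u : I × Ω → Vel n) : MeasTriple n Ω where
  rho := ρ
  omega j := (ρ : Measure (I × Ω)).withDensityᵥ fun p => u p (some j)
  zeta := (ρ : Measure (I × Ω)).withDensityᵥ fun p => δ⁻¹ * u p none

theorem integrable_coord {X : Type*} [MeasurableSpace X] {ρ : Measure X} {u : X → Vel n}
    (hu : Integrable u ρ) (i : Option (Fin n)) : Integrable (fun p => u p i) ρ :=
  (EuclideanSpace.proj i : Vel n →L[ℝ] ℝ).integrable_comp hu

/-- Since the energy does not depend on the reference measure, take `ρ` itself: its density is then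
1, and the factor `δ` stored in the coordinate `none` turns `f_δ` into half a Euclidean square. -/
theorem energy_ofVelocity {δ : ℝ} (hδ : 0 < δ) (ρ : FiniteMeasure (I × Ω)) {u : I × Ω → Vel n}
    (hu : Integrable u (ρ : Measure (I × Ω))) :
    energy δ (ofVelocity δ ρ u) = ∫⁻ p, ENNReal.ofReal (‖u p‖ ^ 2 / 2) ∂(ρ : Measure (I × Ω)) := by
  rw [← costWrt_eq_energy δ (ofVelocity δ ρ u) (ρ : Measure (I × Ω))
    Measure.AbsolutelyContinuous.rfl
    (fun j => totalVariation_withDensityᵥ_absolutelyContinuous _ _)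
    (totalVariation_withDensityᵥ_absolutelyContinuous _ _)]
  refine lintegral_congr_ae ?_
  have hz : Integrable (fun p => δ⁻¹ * u p none) (ρ : Measure (I × Ω)) :=
    (integrable_coord hu none).const_mul _
  filter_upwards [Measure.rnDeriv_self (ρ : Measure (I × Ω)),
    ae_all_iff.2 fun j => rnDeriv_withDensityᵥ _ (integrable_coord hu (some j)),
    rnDeriv_withDensityᵥ _ hz] with p h1 h2 h3
  simp only [ofVelocity, h1, h2, h3, infCost]
  rw [if_pos (by simp)]
  congr 1
  simp only [EuclideanSpace.real_norm_sq_eq, Fintype.sum_option]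
  field_simp
  simp [add_comm]

theorem memLp_velocity_of_energy_lt_top {δ : ℝ} (hδ : 0 < δ) (ρ : FiniteMeasure (I × Ω))
    {u : I × Ω → Vel n} (hu : Integrable u (ρ : Measure (I × Ω)))
    (h : energy δ (ofVelocity δ ρ u) < ⊤) : MemLp u 2 (ρ : Measure (I × Ω)) := by
  rw [energy_ofVelocity hδ ρ hu] at h
  rw [memLp_two_iff_integrable_sq_norm hu.1]
  have : Integrable (fun p => ‖u p‖ ^ 2 / 2) (ρ : Measure (I × Ω)) := by
    refine ⟨(by have := hu.1.norm.pow 2; fun_prop), ?_⟩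
    rw [hasFiniteIntegral_iff_ofReal (ae_of_all _ fun p => by positivity)]
    exact h
  simpa using this.mul_const 2

theorem energy_ofVelocity_eq_ofReal {δ : ℝ} (hδ : 0 < δ) (ρ : FiniteMeasure (I × Ω))
    {u : I × Ω → Vel n} (hu : MemLp u 2 (ρ : Measure (I × Ω))) :
    energy δ (ofVelocity δ ρ u) = ENNReal.ofReal ((∫ p, ‖u p‖ ^ 2 ∂(ρ : Measure (I × Ω))) / 2) := by
  rw [energy_ofVelocity hδ ρ (hu.integrable one_le_two), ← integral_div,
    ofReal_integral_eq_lintegral_ofReal (hu.integrable_norm_pow two_ne_zero |>.div_const 2)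
      (ae_of_all _ fun p => by positivity)]

/-- A triple of finite energy is given by a square integrable velocity. -/
theorem exists_velocity_of_energy_lt_top {δ : ℝ} (hδ : 0 < δ) (μ : MeasTriple n Ω)
    (h : energy δ μ < ⊤) :
    ∃ u : I × Ω → Vel n, Measurable u ∧ MemLp u 2 (μ.rho : Measure (I × Ω)) ∧
      μ = ofVelocity δ μ.rho u := by
  have hfin : ∀ m : SignedMeasure (I × Ω), IsFiniteMeasure m.totalVariation := fun m => by
    unfold SignedMeasure.totalVariation; infer_instance
  have : IsFiniteMeasure μ.ref := by unfold MeasTriple.ref; infer_instance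
  have hsum : ∀ j, (μ.omega j).totalVariation ≤ ∑ j, (μ.omega j).totalVariation := fun j =>
    Finset.single_le_sum (f := fun j => (μ.omega j).totalVariation)
      (fun _ _ => Measure.zero_le _) (Finset.mem_univ j)
  have hρr : (μ.rho : Measure (I × Ω)) ≪ μ.ref :=
    Measure.absolutelyContinuous_of_le (Measure.le_add_right (Measure.le_add_right le_rfl))
  have hωr : ∀ j, (μ.omega j).totalVariation ≪ μ.ref := fun j =>
    Measure.absolutelyContinuous_of_le (Measure.le_add_right (Measure.le_add_left (hsum j)))
  have hζr : μ.zeta.totalVariation ≪ μ.ref :=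
    Measure.absolutelyContinuous_of_le (Measure.le_add_left le_rfl)
  have hmeas : Measurable fun p => infCost δ ((μ.rho : Measure (I × Ω)).rnDeriv μ.ref p).toReal
      (WithLp.toLp 2 fun j => (μ.omega j).rnDeriv μ.ref p) (μ.zeta.rnDeriv μ.ref p) := by
    refine (measurable_infCost δ).comp (f := fun p => (_, _, _)) ?_
    refine (Measure.measurable_rnDeriv _ _).ennreal_toReal.prodMk
      (Measurable.prodMk ?_ (SignedMeasure.measurable_rnDeriv _ _))
    exact (WithLp.measurable_toLp 2 _).comp
      (measurable_pi_lambda _ fun j => SignedMeasure.measurable_rnDeriv _ _)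
  -- The cost is finite almost everywhere, and where the density of `ρ` vanishes its only finite
  -- value is at `w = 0`, `z = 0`.
  have hae : ∀ᵐ p ∂μ.ref, (μ.rho : Measure (I × Ω)).rnDeriv μ.ref p = 0 →
      (∀ j, (μ.omega j).rnDeriv μ.ref p = 0) ∧ μ.zeta.rnDeriv μ.ref p = 0 := by
    filter_upwards [ae_lt_top hmeas h.ne] with p hp h0
    simp only [infCost, h0, ENNReal.toReal_zero, lt_irrefl, if_false, true_and] at hp
    split_ifs at hp with hc
    · exact ⟨fun j => by simpa using congrArg (fun w : EuclideanSpace ℝ (Fin n) => w j) hc.1, hc.2⟩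
    · exact absurd hp (lt_irrefl _)
  have hω : ∀ j, (μ.omega j).totalVariation ≪ (μ.rho : Measure (I × Ω)) := fun j =>
    totalVariation_absolutelyContinuous_of_rnDeriv _ _ μ.ref (hωr j) hρr
      (hae.mono fun p hp h0 => (hp h0).1 j)
  have hζ : μ.zeta.totalVariation ≪ (μ.rho : Measure (I × Ω)) :=
    totalVariation_absolutelyContinuous_of_rnDeriv _ _ μ.ref hζr hρr
      (hae.mono fun p hp h0 => (hp h0).2)
  let u : I × Ω → Vel n := fun p => WithLp.toLp 2 fun i =>
    i.elim (δ * μ.zeta.rnDeriv (μ.rho : Measure (I × Ω)) p)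
      fun j => (μ.omega j).rnDeriv (μ.rho : Measure (I × Ω)) p
  have hui : ∀ i, Integrable (fun p => u p i) (μ.rho : Measure (I × Ω)) := by
    rintro (_ | j)
    · exact (SignedMeasure.integrable_rnDeriv _ _).const_mul δ
    · exact SignedMeasure.integrable_rnDeriv _ _
  have hum : Measurable u := by
    refine (WithLp.measurable_toLp 2 _).comp (measurable_pi_lambda _ ?_)
    rintro (_ | j)
    · exact (SignedMeasure.measurable_rnDeriv _ _).const_mul δ
    · exact SignedMeasure.measurable_rnDeriv _ _
  have hu : Integrable u (μ.rho : Measure (I × Ω)) := by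
    refine (integrable_finsetSum Finset.univ fun i _ => (hui i).norm).mono'
      hum.aestronglyMeasurable (ae_of_all _ fun p => ?_)
    rw [EuclideanSpace.norm_eq]
    refine Real.sqrt_le_iff.2 ⟨by positivity, ?_⟩
    exact Finset.sum_sq_le_sq_sum_of_nonneg fun i _ => norm_nonneg _
  have heq : μ = ofVelocity δ μ.rho u := by
    obtain ⟨ρ, ω, ζ⟩ := μ
    simp only [ofVelocity, MeasTriple.mk.injEq, true_and]
    refine ⟨funext fun j => ?_, ?_⟩
    · exact (withDensityᵥ_rnDeriv_of_absolutelyContinuous _ _ (hω j)).symm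
    · refine (withDensityᵥ_rnDeriv_of_absolutelyContinuous _ _ hζ).symm.trans ?_
      congr 1
      funext p
      simp [u, hδ.ne']
  exact ⟨u, hum, memLp_velocity_of_energy_lt_top hδ _ hu (heq ▸ h), heq⟩

/-! ### The continuity equation in terms of the velocity -/

/-- The test field dual to a velocity: `⟪velTest δ w z, (v, δ g)⟫ = w · v + z g`. -/
def velTest (δ : ℝ) (w : EuclideanSpace ℝ (Fin n)) (z : ℝ) : Vel n :=
  WithLp.toLp 2 fun i => i.elim (δ⁻¹ * z) fun j => w j

theorem continuous_velTest (δ : ℝ) :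
    Continuous fun q : EuclideanSpace ℝ (Fin n) × ℝ => velTest δ q.1 q.2 := by
  refine (PiLp.continuous_toLp 2 _).comp (continuous_pi ?_)
  rintro (_ | j)
  · exact continuous_const.mul continuous_snd
  · exact (EuclideanSpace.proj j : EuclideanSpace ℝ (Fin n) →L[ℝ] ℝ).continuous.comp continuous_fst

theorem inner_velTest (δ : ℝ) (w : EuclideanSpace ℝ (Fin n)) (z : ℝ) (u : Vel n) :
    inner ℝ (velTest δ w z) u = ∑ j, w j * u (some j) + z * (δ⁻¹ * u none) := by
  simp only [PiLp.inner_apply, velTest, Fintype.sum_option, Option.elim]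
  simp only [RCLike.inner_apply, conj_trivial]
  rw [add_comm]
  congr 1
  · exact Finset.sum_congr rfl fun j _ => mul_comm _ _
  · ring

theorem sint_add_sint_eq_integral_inner {Y : Type*} [TopologicalSpace Y] [CompactSpace Y]
    [MeasurableSpace Y] [BorelSpace Y] {ρ : Measure Y} {u : Y → Vel n} (hu : Integrable u ρ)
    (δ : ℝ) {w : Y → EuclideanSpace ℝ (Fin n)} {z : Y → ℝ} (hw : Continuous w)
    (hz : Continuous z) :
    ∑ j, sint (ρ.withDensityᵥ fun p => u p (some j)) (fun p => w p j)
      + sint (ρ.withDensityᵥ fun p => δ⁻¹ * u p none) z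
      = ∫ p, inner ℝ (velTest δ (w p) (z p)) (u p) ∂ρ := by
  have key : ∀ {v f : Y → ℝ}, Integrable v ρ → Continuous f →
      sint (ρ.withDensityᵥ v) f = ∫ x, f x * v x ∂ρ ∧ Integrable (fun x => f x * v x) ρ := by
    intro v f hv hf
    obtain ⟨C, hC⟩ := (isCompact_range hf).isBounded.exists_norm_le
    have hC' : ∀ x, ‖f x‖ ≤ C := fun x => hC _ ⟨x, rfl⟩
    exact ⟨sint_withDensityᵥ hv hf.measurable hC',
      hv.bdd_mul (c := C) hf.measurable.aestronglyMeasurable (ae_of_all _ hC')⟩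
  have hwj : ∀ j, Continuous fun p => w p j := fun j =>
    (EuclideanSpace.proj j : EuclideanSpace ℝ (Fin n) →L[ℝ] ℝ).continuous.comp hw
  have hun := (integrable_coord hu none).const_mul δ⁻¹
  simp_rw [inner_velTest]
  rw [integral_add (integrable_finsetSum _ fun j _ =>
    (key (integrable_coord hu (some j)) (hwj j)).2) (key hun hz).2,
    integral_finsetSum _ fun j _ => (key (integrable_coord hu (some j)) (hwj j)).2,
    (key hun hz).1]
  congr 1
  exact Finset.sum_congr rfl fun j _ => (key (integrable_coord hu (some j)) (hwj j)).1

theorem continuous_partial_deriv {φ : ℝ × EuclideanSpace ℝ (Fin n) → ℝ} (hφ : ContDiff ℝ 1 φ) :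
    Continuous fun p : I × Ω => deriv (fun s : ℝ => φ (s, p.2)) p.1 := by
  have h : ∀ p : I × Ω, deriv (fun s : ℝ => φ (s, p.2)) p.1
      = fderiv ℝ φ ((p.1 : ℝ), (p.2 : EuclideanSpace ℝ (Fin n))) (1, 0) := fun p => by
    have h1 := (hφ.differentiable one_ne_zero
      ((p.1 : ℝ), (p.2 : EuclideanSpace ℝ (Fin n)))).hasFDerivAt
    exact (h1.comp_hasDerivAt (p.1 : ℝ)
      ((hasDerivAt_id (p.1 : ℝ)).prodMk (hasDerivAt_const (p.1 : ℝ) _))).deriv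
  simp_rw [h]
  have := hφ.continuous_fderiv one_ne_zero
  fun_prop

theorem continuous_partial_gradient {φ : ℝ × EuclideanSpace ℝ (Fin n) → ℝ}
    (hφ : ContDiff ℝ 1 φ) :
    Continuous fun p : I × Ω =>
      gradient (fun y : EuclideanSpace ℝ (Fin n) => φ (p.1, y)) p.2 := by
  have h : ∀ p : I × Ω, gradient (fun y : EuclideanSpace ℝ (Fin n) => φ (p.1, y)) p.2
      = (InnerProductSpace.toDual ℝ (EuclideanSpace ℝ (Fin n))).symm
        ((fderiv ℝ φ ((p.1 : ℝ), (p.2 : EuclideanSpace ℝ (Fin n)))).comp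
          (ContinuousLinearMap.inr ℝ ℝ _)) := fun p => by
    have h1 := (hφ.differentiable one_ne_zero
      ((p.1 : ℝ), (p.2 : EuclideanSpace ℝ (Fin n)))).hasFDerivAt
    rw [gradient]
    congr 1
    exact (h1.comp (p.2 : EuclideanSpace ℝ (Fin n))
      ((hasFDerivAt_const (p.1 : ℝ) _).prodMk (hasFDerivAt_id _))).fderiv
  simp_rw [h]
  have := hφ.continuous_fderiv one_ne_zero
  refine (LinearIsometryEquiv.continuous _).comp ?_
  fun_prop

/-- Both integrals on the left have continuous integrands against `ρ` and `uρ`, which is the form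
that passes to weak limits. -/
theorem ofVelocity_mem_CE_iff [CompactSpace Ω] {δ : ℝ} {ρ : FiniteMeasure (I × Ω)}
    {u : I × Ω → Vel n} (hu : Integrable u (ρ : Measure (I × Ω))) (ρ₀ ρ₁ : FiniteMeasure Ω) :
    ofVelocity δ ρ u ∈ CE ρ₀ ρ₁ ↔ ∀ φ : ℝ × EuclideanSpace ℝ (Fin n) → ℝ, ContDiff ℝ 1 φ →
      (∫ p : I × Ω, deriv (fun s : ℝ => φ (s, p.2)) p.1 ∂(ρ : Measure (I × Ω)))
        + (∫ p : I × Ω, inner ℝ (velTest δ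
            (gradient (fun y : EuclideanSpace ℝ (Fin n) => φ (p.1, y)) p.2)
            (φ (p.1, p.2))) (u p) ∂(ρ : Measure (I × Ω)))
      = (∫ x : Ω, φ (1, x) ∂(ρ₁ : Measure Ω)) - ∫ x : Ω, φ (0, x) ∂(ρ₀ : Measure Ω) := by
  refine forall₂_congr fun φ hφ => ?_
  have hc := hφ.continuous
  rw [add_assoc]
  simp only [ofVelocity]
  rw [sint_add_sint_eq_integral_inner hu δ (continuous_partial_gradient hφ)
      (z := fun p : I × Ω => φ (p.1, p.2)) (by fun_prop)]

/-! ### A priori bounds -/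

theorem integral_unitInterval_eq (ψ : C(I, ℝ)) :
    ∫ t : I, ψ t = ∫ t in (0 : ℝ)..1, Set.IccExtend zero_le_one ψ t := by
  rw [intervalIntegral.integral_of_le zero_le_one, ← integral_Icc_eq_integral_Ioc,
    ← integral_subtype_comap measurableSet_Icc]
  refine integral_congr_ae (ae_of_all _ fun t => ?_)
  simp

/-- Testing the continuity equation with functions of time only. -/
theorem integral_time_add_eq [CompactSpace Ω] {δ : ℝ} {ρ : FiniteMeasure (I × Ω)}
    {u : I × Ω → Vel n} (hu : Integrable u (ρ : Measure (I × Ω))) {ρ₀ ρ₁ : FiniteMeasure Ω}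
    (h : ofVelocity δ ρ u ∈ CE ρ₀ ρ₁) (ψ : C(I, ℝ)) :
    (∫ p, ψ p.1 ∂(ρ : Measure (I × Ω)))
      + (∫ p, (∫ s in (0 : ℝ)..p.1, Set.IccExtend zero_le_one ψ s) * (δ⁻¹ * u p none)
          ∂(ρ : Measure (I × Ω)))
      = (ρ₁ : Measure Ω).real Set.univ * ∫ t : I, ψ t := by
  have hψ : Continuous (Set.IccExtend zero_le_one ψ : ℝ → ℝ) := ψ.continuous.Icc_extend'
  -- The primitive vanishing at time 0 removes `ρ₀` from the identity.
  set Φ : ℝ → ℝ := fun t => ∫ s in (0 : ℝ)..t, Set.IccExtend zero_le_one ψ s with hΦ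
  have hd : ∀ t, HasDerivAt Φ (Set.IccExtend zero_le_one ψ t) t := fun t =>
    intervalIntegral.integral_hasDerivAt_right (hψ.intervalIntegrable _ _)
      (hψ.stronglyMeasurableAtFilter _ _) hψ.continuousAt
  have hΦ1 : ContDiff ℝ 1 Φ := by
    rw [contDiff_one_iff_deriv]
    refine ⟨fun t => (hd t).differentiableAt, ?_⟩
    rwa [show deriv Φ = _ from funext fun t => (hd t).deriv]
  have := (ofVelocity_mem_CE_iff hu ρ₀ ρ₁).1 h (fun q => Φ q.1) (hΦ1.comp contDiff_fst)
  simp only [inner_velTest, (hd _).deriv] at this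
  have hg : ∀ (c : ℝ) (x : EuclideanSpace ℝ (Fin n)),
      gradient (fun _ : EuclideanSpace ℝ (Fin n) => c) x = 0 := fun c x => by
    simp [gradient]
  have h0 : Φ 0 = 0 := by simp [hΦ]
  simp only [hg, PiLp.zero_apply, zero_mul, Finset.sum_const_zero, zero_add, integral_const,
    h0, Set.IccExtend_val, smul_eq_mul, mul_zero, sub_zero] at this
  rw [integral_unitInterval_eq]
  exact this

/-- The primitive of `ψ` lies between 0 and `∫ ψ` on `[0,1]`, and the growth rate satisfies `|δ⁻¹
u_none| ≤ 1/2 + δ⁻² ‖u‖² / 2`. Hence the source term is at most `∫ ψ` times half the mass plus `δ⁻²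
E`. -/
theorem integral_time_le [CompactSpace Ω] {δ E : ℝ} (hδ : 0 < δ) {ρ : FiniteMeasure (I × Ω)}
    {u : I × Ω → Vel n} (hu : MemLp u 2 (ρ : Measure (I × Ω))) {ρ₀ ρ₁ : FiniteMeasure Ω}
    (h : ofVelocity δ ρ u ∈ CE ρ₀ ρ₁) (hE : ∫ p, ‖u p‖ ^ 2 ∂(ρ : Measure (I × Ω)) ≤ 2 * E)
    (ψ : C(I, ℝ)) (hψ : ∀ t, 0 ≤ ψ t) :
    ∫ p, ψ p.1 ∂(ρ : Measure (I × Ω)) ≤ ((ρ₁ : Measure Ω).real Set.univ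
      + (ρ : Measure (I × Ω)).real Set.univ / 2 + δ⁻¹ ^ 2 * E) * ∫ t : I, ψ t := by
  have hui := hu.integrable one_le_two
  have key := integral_time_add_eq hui h ψ
  have hψc : Continuous (Set.IccExtend zero_le_one ψ : ℝ → ℝ) := ψ.continuous.Icc_extend'
  have hψn : ∀ s, 0 ≤ Set.IccExtend zero_le_one ψ s := fun s => hψ _
  set c := ∫ t : I, ψ t with hc
  have hc0 : 0 ≤ c := integral_nonneg hψ
  have hb : ∀ t : I, |∫ s in (0 : ℝ)..t, Set.IccExtend zero_le_one ψ s| ≤ c := fun t => by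
    rw [abs_of_nonneg (intervalIntegral.integral_nonneg t.2.1 fun s _ => hψn s), hc,
      integral_unitInterval_eq]
    exact intervalIntegral.integral_mono_interval le_rfl t.2.1 t.2.2
      (ae_of_all _ fun s => hψn s) (hψc.intervalIntegrable _ _)
  have hsq := hu.integrable_norm_pow two_ne_zero
  have hle : -∫ p, (∫ s in (0 : ℝ)..p.1, Set.IccExtend zero_le_one ψ s) * (δ⁻¹ * u p none)
      ∂(ρ : Measure (I × Ω)) ≤ ∫ p, c * (1 / 2 + δ⁻¹ ^ 2 * ‖u p‖ ^ 2 / 2)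
        ∂(ρ : Measure (I × Ω)) := by
    refine (neg_le_abs _).trans ((abs_integral_le_integral_abs).trans ?_)
    refine integral_mono_of_nonneg (ae_of_all _ fun p => abs_nonneg _)
      (((integrable_const _).add ((hsq.const_mul _).div_const 2)).const_mul c)
      (ae_of_all _ fun p => ?_)
    simp only [abs_mul]
    refine mul_le_mul (hb p.1) ?_ (by positivity) hc0
    have h1 : |u p none| ≤ ‖u p‖ := PiLp.norm_apply_le (p := 2) (u p) none
    have h2 : |δ⁻¹| = δ⁻¹ := abs_of_pos (by positivity)
    rw [h2]
    nlinarith [mul_le_mul_of_nonneg_left h1 (inv_pos.2 hδ).le, sq_nonneg (δ⁻¹ * ‖u p‖ - 1)]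
  have heval : ∫ p, c * (1 / 2 + δ⁻¹ ^ 2 * ‖u p‖ ^ 2 / 2) ∂(ρ : Measure (I × Ω))
      = c * ((ρ : Measure (I × Ω)).real Set.univ / 2
        + δ⁻¹ ^ 2 * (∫ p, ‖u p‖ ^ 2 ∂(ρ : Measure (I × Ω))) / 2) := by
    rw [integral_const_mul, integral_add (integrable_const _) ((hsq.const_mul _).div_const 2),
      integral_const, integral_div, integral_const_mul, smul_eq_mul]
    ring
  have hE' : δ⁻¹ ^ 2 * (∫ p, ‖u p‖ ^ 2 ∂(ρ : Measure (I × Ω))) / 2 ≤ δ⁻¹ ^ 2 * E := by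
    nlinarith [mul_le_mul_of_nonneg_left hE (sq_nonneg δ⁻¹)]
  nlinarith [mul_le_mul_of_nonneg_left hE' hc0]

/-- Total mass bound for solutions of the continuity equation with energy at most `E`. -/
theorem mass_le [CompactSpace Ω] {δ E : ℝ} (hδ : 0 < δ) {ρ : FiniteMeasure (I × Ω)}
    {u : I × Ω → Vel n} (hu : MemLp u 2 (ρ : Measure (I × Ω))) {ρ₀ ρ₁ : FiniteMeasure Ω}
    (h : ofVelocity δ ρ u ∈ CE ρ₀ ρ₁) (hE : ∫ p, ‖u p‖ ^ 2 ∂(ρ : Measure (I × Ω)) ≤ 2 * E) :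
    (ρ : Measure (I × Ω)).real Set.univ
      ≤ 2 * (ρ₁ : Measure Ω).real Set.univ + 2 * (δ⁻¹ ^ 2 * E) := by
  -- With `ψ = 1` the total mass is on the left and half of it on the right, so it can be absorbed.
  have := integral_time_le hδ hu h hE 1 (fun t => zero_le_one)
  simp only [ContinuousMap.one_apply, integral_const, probReal_univ, smul_eq_mul, mul_one] at this
  linarith

/-- The time marginal of a solution of the continuity equation with energy at most `E` has a
density bounded in terms of `E`. -/
theorem integral_time_le_bound [CompactSpace Ω] {δ E : ℝ} (hδ : 0 < δ)
    {ρ : FiniteMeasure (I × Ω)}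
    {u : I × Ω → Vel n} (hu : MemLp u 2 (ρ : Measure (I × Ω))) {ρ₀ ρ₁ : FiniteMeasure Ω}
    (h : ofVelocity δ ρ u ∈ CE ρ₀ ρ₁) (hE : ∫ p, ‖u p‖ ^ 2 ∂(ρ : Measure (I × Ω)) ≤ 2 * E)
    (ψ : C(I, ℝ)) (hψ : ∀ t, 0 ≤ ψ t) :
    ∫ p, ψ p.1 ∂(ρ : Measure (I × Ω))
      ≤ (2 * (ρ₁ : Measure Ω).real Set.univ + 2 * (δ⁻¹ ^ 2 * E)) * ∫ t : I, ψ t := by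
  refine (integral_time_le hδ hu h hE ψ hψ).trans ?_
  refine mul_le_mul_of_nonneg_right ?_ (integral_nonneg hψ)
  linarith [mass_le hδ hu h hE]

/-! ### Comparison through continuous test functions -/

/-- Outer regularity of `ν₂` reduces the comparison to open sets, whose measure is a supremum of
integrals of nonnegative continuous functions. -/
theorem measure_le_of_forall_integral_continuous_le {Y : Type*} [TopologicalSpace Y] [T2Space Y]
    [NormalSpace Y] [MeasurableSpace Y] [BorelSpace Y] (ν₁ ν₂ : Measure Y) [IsFiniteMeasure ν₁]
    [IsFiniteMeasure ν₂] [ν₁.InnerRegularCompactLTTop] [ν₂.OuterRegular]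
    [ν₂.InnerRegularCompactLTTop]
    (h : ∀ ψ : C(Y, ℝ), (∀ t, 0 ≤ ψ t) → ∫ t, ψ t ∂ν₁ ≤ ∫ t, ψ t ∂ν₂) : ν₁ ≤ ν₂ := by
  refine Measure.le_intro fun A _ _ => ?_
  rw [A.measure_eq_iInf_isOpen ν₂]
  refine le_iInf fun U => le_iInf fun hAU => le_iInf fun hU => (measure_mono hAU).trans ?_
  rw [hU.measure_eq_biSup_integral_continuous ν₁, hU.measure_eq_biSup_integral_continuous ν₂]
  refine iSup_mono fun f => iSup_mono fun hf => iSup_mono fun _ => iSup_mono fun h0 =>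
    iSup_mono fun _ => ENNReal.ofReal_le_ofReal (h ⟨f, hf⟩ h0)

/-- The hypothesis compares the measures whose densities are the negative and positive parts of `g -
f`. Their ordering as measures gives the ordering of the densities a.e., and the negative part can
be below the positive part only where it is zero. -/
theorem ae_le_of_forall_integral_continuous_mul_le {f g : I → ℝ} (hf : Integrable f)
    (hg : Integrable g)
    (h : ∀ ψ : C(I, ℝ), (∀ t, 0 ≤ ψ t) → ∫ t, ψ t * f t ≤ ∫ t, ψ t * g t) :
    ∀ᵐ t, f t ≤ g t := by
  have hF : Integrable (fun t => g t - f t) := hg.sub hf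
  have hbdd : ∀ (ψ : C(I, ℝ)) {v : I → ℝ}, Integrable v → Integrable fun t => ψ t * v t :=
    fun ψ v hv => hv.bdd_mul (c := ‖ψ‖) ψ.continuous.measurable.aestronglyMeasurable
      (ae_of_all _ ψ.norm_coe_le_norm)
  have h1 := isFiniteMeasure_withDensity_ofReal hF.2
  have h2 : IsFiniteMeasure (volume.withDensity fun t => ENNReal.ofReal (-(g t - f t))) :=
    isFiniteMeasure_withDensity_ofReal hF.neg.2
  have key : ∀ (ψ : C(I, ℝ)) (v : I → ℝ), Integrable v →
      ∫ t, ψ t ∂(volume.withDensity fun t => ENNReal.ofReal (v t)) = ∫ t, ψ t * max (v t) 0 := by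
    intro ψ v hv
    rw [integral_withDensity_eq_integral_toReal_smul₀ hv.1.aemeasurable.ennreal_ofReal
      (ae_of_all _ fun _ => ENNReal.ofReal_lt_top)]
    refine integral_congr_ae (ae_of_all _ fun x => ?_)
    simp [ENNReal.toReal_ofReal', mul_comm]
  have hle : (volume.withDensity fun t => ENNReal.ofReal (-(g t - f t)))
      ≤ volume.withDensity fun t => ENNReal.ofReal (g t - f t) := by
    refine measure_le_of_forall_integral_continuous_le _ _ fun ψ hψ => ?_
    rw [key ψ (fun t => -(g t - f t)) hF.neg, key ψ _ hF, ← sub_nonneg,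
      ← integral_sub (hbdd ψ hF.pos_part) (hbdd ψ (v := fun t => max (-(g t - f t)) 0) hF.neg.pos_part)]
    have := h ψ hψ
    rw [← sub_nonneg, ← integral_sub (hbdd ψ hg) (hbdd ψ hf)] at this
    refine this.trans_eq (integral_congr_ae (ae_of_all _ fun t => ?_))
    rcases le_total 0 (g t - f t) with h | h
    · simp only [max_eq_left h, max_eq_right (neg_nonpos.2 h)]; ring
    · simp only [max_eq_right h, max_eq_left (neg_nonneg.2 h)]; ring
  have hae := ae_le_of_forall_setLIntegral_le_of_sigmaFinite₀ (μ := (volume : Measure I))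
    (f := fun t => ENNReal.ofReal (-(g t - f t))) (g := fun t => ENNReal.ofReal (g t - f t))
    hF.neg.1.aemeasurable.ennreal_ofReal fun s hs _ => by
      rw [← withDensity_apply _ hs, ← withDensity_apply _ hs]
      exact hle s
  filter_upwards [hae] with t ht
  by_contra hlt
  push Not at hlt
  rw [ENNReal.ofReal_of_nonpos (by linarith : g t - f t ≤ 0), nonpos_iff_eq_zero,
    ENNReal.ofReal_eq_zero] at ht
  linarith

/-! ### Disintegration in time -/

theorem isPiSystem_generateSetAlgebra {α : Type*} (𝒜 : Set (Set α)) :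
    IsPiSystem (generateSetAlgebra 𝒜) := fun _ hs _ ht _ =>
  isSetAlgebra_generateSetAlgebra.inter_mem hs ht

theorem exists_countable_isPiSystem (α : Type*) [m : MeasurableSpace α]
    [MeasurableSpace.CountablyGenerated α] :
    ∃ S : Set (Set α), S.Countable ∧ IsPiSystem S ∧ Set.univ ∈ S ∧
      m = MeasurableSpace.generateFrom S := by
  refine ⟨generateSetAlgebra (MeasurableSpace.countableGeneratingSet α),
    countable_generateSetAlgebra MeasurableSpace.countable_countableGeneratingSet,
    isPiSystem_generateSetAlgebra _, isSetAlgebra_generateSetAlgebra.univ_mem, ?_⟩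
  rw [generateFrom_generateSetAlgebra_eq, MeasurableSpace.generateFrom_countableGeneratingSet]

/-- For each fixed set the slices agree for a.e. `t`. A countable generating π-system makes the null
set independent of the set. Thus the choice of disintegration in the constraints is immaterial. -/
theorem IsDisintegration.ae_eq {ρ : FiniteMeasure (I × Ω)} {r r' : I → FiniteMeasure Ω}
    (h : IsDisintegration ρ r) (h' : IsDisintegration ρ r') : ∀ᵐ t, r t = r' t := by
  obtain ⟨S, hSc, hSp, hSu, hS⟩ := exists_countable_isPiSystem Ω
  have hm : ∀ B ∈ S, MeasurableSet B := fun B hB => by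
    rw [hS]; exact MeasurableSpace.measurableSet_generateFrom hB
  have hB : ∀ B ∈ S, ∀ᵐ t, (r t : Measure Ω) B = (r' t : Measure Ω) B := fun B hB =>
    ae_eq_of_forall_setLIntegral_eq_of_sigmaFinite (h.measurable B (hm B hB))
      (h'.measurable B (hm B hB)) fun A hA _ => by
        rw [← h.apply_prod A B hA (hm B hB), ← h'.apply_prod A B hA (hm B hB)]
  filter_upwards [(ae_ball_iff hSc).2 hB] with t ht
  have : IsFiniteMeasure (r t : Measure Ω) := inferInstance
  exact FiniteMeasure.toMeasure_injective (ext_of_generate_finite S hS hSp ht (ht _ hSu))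

theorem IsSignedDisintegration.ae_eq {m : SignedMeasure (I × Ω)} {s s' : I → SignedMeasure Ω}
    (h : IsSignedDisintegration m s) (h' : IsSignedDisintegration m s') : ∀ᵐ t, s t = s' t := by
  obtain ⟨S, hSc, hSp, hSu, hS⟩ := exists_countable_isPiSystem Ω
  have hm : ∀ B ∈ S, MeasurableSet B := fun B hB => by
    rw [hS]; exact MeasurableSpace.measurableSet_generateFrom hB
  have hB : ∀ B ∈ S, ∀ᵐ t, s t B = s' t B := fun B hB =>
    Integrable.ae_eq_of_forall_setIntegral_eq _ _ (h.integrable B (hm B hB))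
      (h'.integrable B (hm B hB)) fun A hA _ => by
        rw [← h.apply_prod A B hA (hm B hB), ← h'.apply_prod A B hA (hm B hB)]
  filter_upwards [(ae_ball_iff hSc).2 hB] with t ht
  exact VectorMeasure.ext_of_generateFrom S ht hS hSp (ht _ hSu)

open ProbabilityTheory in
-- Multiply the conditional probabilities of `ρ` given `t` by the Lebesgue density of the time
-- marginal.
theorem exists_kernel_compProd_eq [CompactSpace Ω] [Nonempty Ω] (ρ : Measure (I × Ω))
    [IsFiniteMeasure ρ] (hρ : ρ.fst ≪ volume) :
    ∃ κ : Kernel I Ω, IsSFiniteKernel κ ∧ (∀ t, IsFiniteMeasure (κ t)) ∧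
      (volume : Measure I) ⊗ₘ κ = ρ := by
  -- `toNNReal` replaces a possible value `∞` by 0, so every slice is finite, not just almost every
  -- one.
  let m : I → NNReal := fun t => (ρ.fst.rnDeriv volume t).toNNReal
  have hm : Measurable m := (Measure.measurable_rnDeriv _ _).ennreal_toNNReal
  have hmu : Measurable (Function.uncurry fun (t : I) (_ : Ω) => (m t : ℝ≥0∞)) :=
    (hm.comp measurable_fst).coe_nnreal_ennreal
  let κ : Kernel I Ω := Kernel.withDensity ρ.condKernel fun t _ => (m t : ℝ≥0∞)
  have hκ : ∀ t B, κ t B = m t * ρ.condKernel t B := fun t B => by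
    rw [Kernel.withDensity_apply' _ hmu]; simp
  have hsf : IsSFiniteKernel κ :=
    Kernel.IsSFiniteKernel.withDensity _ fun _ _ => ENNReal.coe_ne_top
  have hfst : IsFiniteMeasure ρ.fst := inferInstance
  have hvol : IsFiniteMeasure (volume : Measure I) := inferInstance
  have hLeb : ρ.fst.HaveLebesgueDecomposition (volume : Measure I) :=
    Measure.haveLebesgueDecomposition_of_sigmaFinite _ _
  refine ⟨κ, hsf, fun t => ⟨?_⟩, ?_⟩
  · rw [hκ]; simp
  · conv_rhs => rw [← ρ.disintegrate ρ.condKernel]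
    have hprod : ∀ A B, MeasurableSet A → MeasurableSet B →
        ((volume : Measure I) ⊗ₘ κ) (A ×ˢ B) = (ρ.fst ⊗ₘ ρ.condKernel) (A ×ˢ B) := by
      intro A B hA hB
      rw [Measure.compProd_apply_prod hA hB, Measure.compProd_apply_prod hA hB,
        ← setLIntegral_rnDeriv_mul hρ (Kernel.measurable_coe _ hB).aemeasurable hA]
      refine lintegral_congr_ae (ae_restrict_of_ae ?_)
      filter_upwards [ρ.fst.rnDeriv_lt_top volume] with t ht
      rw [hκ, ENNReal.coe_toNNReal ht.ne]
    refine (ext_of_generate_finite _ generateFrom_prod.symm isPiSystem_prod ?_ ?_).symm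
    · rintro _ ⟨A, hA, B, hB, rfl⟩
      exact (hprod A B hA hB).symm
    · rw [← Set.univ_prod_univ]
      exact (hprod _ _ .univ .univ).symm

open ProbabilityTheory in
theorem isDisintegration_of_kernel {ρ : FiniteMeasure (I × Ω)} (κ : Kernel I Ω)
    [IsSFiniteKernel κ] (hfin : ∀ t, IsFiniteMeasure (κ t))
    (hκ : (volume : Measure I) ⊗ₘ κ = (ρ : Measure (I × Ω))) :
    IsDisintegration ρ fun t => ⟨κ t, hfin t⟩ where
  measurable B hB := κ.measurable_coe hB
  apply_prod A B hA hB := by rw [← hκ, Measure.compProd_apply_prod hA hB]; rfl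

open ProbabilityTheory in
theorem integrable_integral_of_compProd {κ : Kernel I Ω} [IsSFiniteKernel κ] {f : I × Ω → ℝ}
    (hf : Integrable f ((volume : Measure I) ⊗ₘ κ)) : Integrable fun t => ∫ x, f (t, x) ∂κ t := by
  simpa using Integrable.integral_compProd hf

open ProbabilityTheory in
theorem isSignedDisintegration_of_kernel {ρ : Measure (I × Ω)} (κ : Kernel I Ω)
    [IsSFiniteKernel κ] (hκ : (volume : Measure I) ⊗ₘ κ = ρ)
    {v : I × Ω → ℝ} (hv : Measurable v) (hvi : Integrable v ρ) :
    IsSignedDisintegration (ρ.withDensityᵥ v) fun t => (κ t).withDensityᵥ fun x => v (t, x) := by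
  subst hκ
  have hae := ((Measure.integrable_compProd_iff hvi.1).1 hvi).1
  have hint : ∀ B : Set Ω, MeasurableSet B →
      Integrable (fun t => ∫ x in B, v (t, x) ∂κ t) := fun B hB => by
    have h1 := integrable_integral_of_compProd
      (hvi.indicator (MeasurableSet.univ (α := I) |>.prod hB))
    refine h1.congr (ae_of_all _ fun t => ?_)
    simp only
    rw [← integral_indicator hB]
    congr 1
    funext x
    by_cases hx : x ∈ B <;> simp [hx]
  have hval : ∀ B : Set Ω, MeasurableSet B → ∀ᵐ t,
      ((κ t).withDensityᵥ fun x => v (t, x)) B = ∫ x in B, v (t, x) ∂κ t := fun B hB => by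
    filter_upwards [hae] with t ht using withDensityᵥ_apply ht hB
  refine ⟨fun B hB => ?_, fun B hB => (hint B hB).congr ((hval B hB).mono fun t ht => ht.symm),
    fun A B hA hB => ?_⟩
  · have hset : MeasurableSet {t | Integrable (fun x => v (t, x)) (κ t)} :=
      measurableSet_kernel_integrable (f := fun t x => v (t, x)) hv.stronglyMeasurable
    -- `withDensityᵥ` is zero by default for a nonintegrable density, so measurability in `t` needs
    -- a cutoff to the times where the slice is integrable.
    have heq : (fun t => ((κ t).withDensityᵥ fun x => v (t, x)) B)
        = {t | Integrable (fun x => v (t, x)) (κ t)}.indicator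
          fun t => ∫ x, B.indicator (fun x => v (t, x)) x ∂κ t := by
      funext t
      by_cases ht : Integrable (fun x => v (t, x)) (κ t)
      · rw [Set.indicator_of_mem (by exact ht), withDensityᵥ_apply ht hB, integral_indicator hB]
      · rw [Set.indicator_of_notMem (by exact ht), Measure.withDensityᵥ, dif_neg ht]
        rfl
    rw [heq]
    refine Measurable.indicator ?_ hset
    refine (MeasureTheory.StronglyMeasurable.integral_kernel_prod_right
      (f := fun t x => B.indicator (fun x => v (t, x)) x) ?_).measurable
    exact (hv.indicator (measurable_snd hB)).stronglyMeasurable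
  · rw [withDensityᵥ_apply hvi (hA.prod hB), Measure.setIntegral_compProd hA hB hvi.integrableOn]
    exact setIntegral_congr_ae hA ((hval B hB).mono fun t ht _ => ht.symm)

/-- The pairing of a constraint with a velocity at a space-time point. -/
def constraintDensity (δ : ℝ) (h : I × Ω → ℝ × EuclideanSpace ℝ (Fin n) × ℝ)
    (u : I × Ω → Vel n) (p : I × Ω) : ℝ :=
  (h p).1 + inner ℝ (velTest δ (h p).2.1 (h p).2.2) (u p)

theorem integrable_inner_continuous {Y : Type*} [TopologicalSpace Y] [CompactSpace Y]
    [MeasurableSpace Y] [BorelSpace Y] {ρ : Measure Y} {b u : Y → Vel n}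
    (hu : Integrable u ρ) (hb : Continuous b) : Integrable (fun p => inner ℝ (b p) (u p)) ρ := by
  obtain ⟨C, hC⟩ := (isCompact_range hb).isBounded.exists_norm_le
  refine (hu.norm.const_mul C).mono' (hb.measurable.aestronglyMeasurable.inner hu.1)
    (ae_of_all _ fun p => (norm_inner_le_norm _ _).trans ?_)
  exact mul_le_mul_of_nonneg_right (hC _ ⟨p, rfl⟩) (norm_nonneg _)

theorem integrable_constraintDensity [CompactSpace Ω] (δ : ℝ)
    {ρ : Measure (I × Ω)} [IsFiniteMeasure ρ] {u : I × Ω → Vel n} (hu : Integrable u ρ)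
    {h : I × Ω → ℝ × EuclideanSpace ℝ (Fin n) × ℝ} (hh : Continuous h) :
    Integrable (constraintDensity δ h u) ρ := by
  have hb : Continuous fun p => velTest δ (h p).2.1 (h p).2.2 :=
    (continuous_velTest δ).comp hh.snd
  exact (hh.fst.integrable_of_hasCompactSupport (.of_compactSpace _)).add
    (integrable_inner_continuous hu hb)

/-- Membership in the constraint sets depends on the slice functional along one canonical
disintegration, which is the conditional expectation in time of the constraint density. -/
theorem exists_slice_function [CompactSpace Ω] [Nonempty Ω] (δ : ℝ)
    {ρ : FiniteMeasure (I × Ω)} (hρ : (ρ : Measure (I × Ω)).fst ≪ volume) {u : I × Ω → Vel n}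
    (hum : Measurable u) (hu : Integrable u (ρ : Measure (I × Ω)))
    {h : I × Ω → ℝ × EuclideanSpace ℝ (Fin n) × ℝ} (hh : Continuous h) :
    ∃ S : I → ℝ, Integrable S ∧
      (∀ (R : ℝ → ℝ → Prop) (F : I → ℝ), ofVelocity δ ρ u ∈ Aff R h F ↔ ∀ᵐ t, R (S t) (F t)) ∧
      ∀ ψ : C(I, ℝ), ∫ t, ψ t * S t
        = ∫ p, ψ p.1 * constraintDensity δ h u p ∂(ρ : Measure (I × Ω)) := by
  obtain ⟨κ, hsf, hfin, hκ⟩ := exists_kernel_compProd_eq _ hρ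
  have hcoord : ∀ i, Measurable fun p => u p i := fun i =>
    (EuclideanSpace.proj i : Vel n →L[ℝ] ℝ).measurable.comp hum
  have hr := isDisintegration_of_kernel κ hfin hκ
  have hw := fun j => isSignedDisintegration_of_kernel κ hκ (hcoord (some j))
    (integrable_coord hu (some j))
  have hz := isSignedDisintegration_of_kernel κ hκ ((hcoord none).const_mul δ⁻¹)
    ((integrable_coord hu none).const_mul δ⁻¹)
  have hG := integrable_constraintDensity δ hu hh
  have hslice : ∀ᵐ t, sliceFunctional h t ⟨κ t, hfin t⟩
      (fun j => (κ t).withDensityᵥ fun x => u (t, x) (some j))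
      ((κ t).withDensityᵥ fun x => δ⁻¹ * u (t, x) none)
      = ∫ x, constraintDensity δ h u (t, x) ∂κ t := by
    rw [← hκ] at hu
    filter_upwards [((Measure.integrable_compProd_iff hu.1).1 hu).1] with t ht
    have hht : Continuous fun x : Ω => h (t, x) := by fun_prop
    have := hfin t
    unfold sliceFunctional constraintDensity
    rw [add_assoc, sint_add_sint_eq_integral_inner ht δ (w := fun x => (h (t, x)).2.1)
      (z := fun x => (h (t, x)).2.2) hht.snd.fst hht.snd.snd, integral_add]
    · rfl
    · exact hht.fst.integrable_of_hasCompactSupport (.of_compactSpace _)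
    · exact integrable_inner_continuous ht ((continuous_velTest δ).comp hht.snd)
  refine ⟨fun t => ∫ x, constraintDensity δ h u (t, x) ∂κ t, ?_, fun R F => ⟨?_, fun hR => ?_⟩,
    fun ψ => ?_⟩
  · rw [← hκ] at hG
    exact integrable_integral_of_compProd hG
  · rintro ⟨r, w, z, hr', hw', hz', hR⟩
    filter_upwards [hR, hslice, hr.ae_eq hr', ae_all_iff.2 fun j => (hw j).ae_eq (hw' j),
      hz.ae_eq hz'] with t h1 h2 h3 h4 h5
    rw [← h2, h3, h5, show (fun j => (κ t).withDensityᵥ fun x => u (t, x) (some j)) = w t from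
      funext h4]
    exact h1
  · refine ⟨_, fun t j => (κ t).withDensityᵥ fun x => u (t, x) (some j), _, hr, hw, hz, ?_⟩
    filter_upwards [hR, hslice] with t h1 h2
    rw [h2]
    exact h1
  · have hψ : Integrable (fun p : I × Ω => ψ p.1 * constraintDensity δ h u p)
        (ρ : Measure (I × Ω)) :=
      hG.bdd_mul (c := ‖ψ‖) (ψ.continuous.comp continuous_fst).measurable.aestronglyMeasurable
        (ae_of_all _ fun p => ψ.norm_coe_le_norm p.1)
    rw [← hκ] at hψ ⊢
    rw [Measure.integral_compProd hψ]
    simp_rw [integral_const_mul]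

/-! ### Compactness -/

open Filter Topology

section Compactness

variable {Y : Type*} [TopologicalSpace Y] [CompactSpace Y]
  [MeasurableSpace Y] [BorelSpace Y] {W : Type*} [NormedAddCommGroup W]
  [InnerProductSpace ℝ W]

theorem norm_toLp_sq (ρ : Measure Y) [IsFiniteMeasure ρ] [SecondCountableTopologyEither Y W]
    (b : C(Y, W)) :
    ‖ContinuousMap.toLp (E := W) 2 ρ ℝ b‖ ^ 2 = ∫ y, ‖b y‖ ^ 2 ∂ρ := by
  rw [← real_inner_self_eq_norm_sq, L2.inner_def]
  refine integral_congr_ae ?_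
  filter_upwards [ContinuousMap.coeFn_toLp (p := 2) (𝕜 := ℝ) ρ b] with y hy
  rw [hy, real_inner_self_eq_norm_sq]

/-- A linear functional on continuous fields dominated by `½ ∫ |b|² dρ + m` is represented by a
field `u` with `½ ∫ |u|² dρ ≤ m`. -/
theorem exists_field_of_quadratic_bound [T2Space Y] [CompleteSpace W] (ρ : Measure Y) [IsFiniteMeasure ρ] [ρ.WeaklyRegular]
    [SecondCountableTopologyEither Y W] (Λ : C(Y, W) →ₗ[ℝ] ℝ) {m : ℝ}
    (hΛ : ∀ b, Λ b ≤ (∫ y, ‖b y‖ ^ 2 ∂ρ) / 2 + m) :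
    ∃ u : Y → W, StronglyMeasurable u ∧ MemLp u 2 ρ ∧ ∫ y, ‖u y‖ ^ 2 ∂ρ ≤ 2 * m ∧
      ∀ b, Λ b = ∫ y, inner ℝ (b y) (u y) ∂ρ := by
  have hm : 0 ≤ m := by simpa using hΛ 0
  let e : C(Y, W) →L[ℝ] Lp W 2 ρ := ContinuousMap.toLp (E := W) 2 ρ ℝ
  have hbound : ∀ b, ‖Λ b‖ ≤ √(2 * m) * ‖e b‖ := fun b => by
    -- Applying the bound to `s • b` for every real `s` gives a nonnegative quadratic in `s`; its
    -- discriminant yields `(Λ b)² ≤ 2 m ‖e b‖²`.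
    have hdisc := discrim_le_zero (a := ‖e b‖ ^ 2 / 2) (b := -Λ b) (c := m) fun s => by
      have h1 := hΛ (s • b)
      rw [← norm_toLp_sq ρ, map_smul, map_smul, norm_smul, mul_pow, Real.norm_eq_abs, sq_abs,
        smul_eq_mul] at h1
      have h2 : ‖ContinuousMap.toLp (E := W) 2 ρ ℝ b‖ = ‖e b‖ := rfl
      rw [h2] at h1
      nlinarith
    rw [Real.norm_eq_abs, ← Real.sqrt_sq (norm_nonneg (e b)), ← Real.sqrt_mul (by positivity)]
    refine Real.abs_le_sqrt ?_
    rw [discrim] at hdisc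
    linarith
  have hdense : DenseRange (e : C(Y, W) →ₗ[ℝ] Lp W 2 ρ) :=
    ContinuousMap.toLp_denseRange W ρ ℝ (by simp)
  -- By this bound `Λ b` depends only on the class of `b` in `L²(ρ)`, so `Λ` extends from the dense
  -- image of `e`.
  let T : Lp W 2 ρ →L[ℝ] ℝ := Λ.extendOfNorm (e : C(Y, W) →ₗ[ℝ] Lp W 2 ρ)
  let U : Lp W 2 ρ := (InnerProductSpace.toDual ℝ (Lp W 2 ρ)).symm T
  have hU : ‖U‖ ≤ √(2 * m) := by
    rw [LinearIsometryEquiv.norm_map]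
    exact LinearMap.opNorm_extendOfNorm_le hdense (Real.sqrt_nonneg _) hbound
  refine ⟨U, Lp.stronglyMeasurable U, Lp.memLp U, ?_, fun b => ?_⟩
  · have h1 : ∫ y, ‖U y‖ ^ 2 ∂ρ = ‖U‖ ^ 2 := by
      rw [← real_inner_self_eq_norm_sq, L2.inner_def]
      simp_rw [real_inner_self_eq_norm_sq]
    rw [h1, ← Real.sq_sqrt (show 0 ≤ 2 * m by positivity)]
    exact pow_le_pow_left₀ (norm_nonneg _) hU 2
  · have h1 : inner ℝ U (e b) = Λ b := by
      rw [InnerProductSpace.toDual_symm_apply]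
      exact LinearMap.extendOfNorm_eq hdense ⟨_, hbound⟩ b
    rw [← h1, real_inner_comm, L2.inner_def]
    refine integral_congr_ae ?_
    filter_upwards [ContinuousMap.coeFn_toLp (p := 2) (𝕜 := ℝ) ρ b] with y hy
    rw [hy]

/-- Weak compactness of pairs of a measure and a square integrable field with bounded mass and
energy; the energy is lower semicontinuous along the limit. -/
theorem exists_weak_limit [T2Space Y] [CompleteSpace W] [SecondCountableTopologyEither Y W]
    [∀ ν : FiniteMeasure Y, (ν : Measure Y).WeaklyRegular] {ρ : ℕ → FiniteMeasure Y}
    {u : ℕ → Y → W} (hu : ∀ k, MemLp (u k) 2 (ρ k : Measure Y)) {C : NNReal}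
    (hC : ∀ k, (ρ k).mass ≤ C) {e : ℕ → ℝ} {m : ℝ} (he : Tendsto e atTop (𝓝 m))
    (hE : ∀ k, ∫ y, ‖u k y‖ ^ 2 ∂(ρ k : Measure Y) ≤ 2 * e k) :
    ∃ (l : Filter ℕ) (ρ' : FiniteMeasure Y) (u' : Y → W), l.NeBot ∧ StronglyMeasurable u' ∧
      MemLp u' 2 (ρ' : Measure Y) ∧ ∫ y, ‖u' y‖ ^ 2 ∂(ρ' : Measure Y) ≤ 2 * m ∧
      (∀ φ : C(Y, ℝ), Tendsto (fun k => ∫ y, φ y ∂(ρ k : Measure Y)) l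
        (𝓝 (∫ y, φ y ∂(ρ' : Measure Y)))) ∧
      ∀ b : C(Y, W), Tendsto (fun k => ∫ y, inner ℝ (b y) (u k y) ∂(ρ k : Measure Y)) l
        (𝓝 (∫ y, inner ℝ (b y) (u' y) ∂(ρ' : Measure Y))) := by
  -- Along an ultrafilter everything that stays in a compact set converges, for all `b`
  -- simultaneously, with no diagonal extraction.
  let l : Ultrafilter ℕ := hyperfilter ℕ
  have hl : (l : Filter ℕ) ≤ atTop := Nat.hyperfilter_le_atTop
  obtain ⟨ρ', -, hρ'⟩ : ∃ ρ' ∈ {ν : FiniteMeasure Y | ν.mass ≤ C}, Tendsto ρ l (𝓝 ρ') := by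
    exact (isCompact_setOfPred_finiteMeasure_le_of_compactSpace Y C).ultrafilter_le_nhds'
      (l.map ρ) (Ultrafilter.mem_map.2 (Eventually.of_forall hC))
  have hφ : ∀ φ : C(Y, ℝ), Tendsto (fun k => ∫ y, φ y ∂(ρ k : Measure Y)) l
      (𝓝 (∫ y, φ y ∂(ρ' : Measure Y))) := fun φ =>
    FiniteMeasure.tendsto_iff_forall_integral_tendsto.1 hρ'
      (BoundedContinuousFunction.mkOfCompact φ)
  have hbi : ∀ (ν : FiniteMeasure Y) (φ : C(Y, ℝ)), Integrable φ (ν : Measure Y) := fun ν φ =>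
    φ.continuous.integrable_of_hasCompactSupport (.of_compactSpace _)
  let nsq : C(Y, W) → C(Y, ℝ) := fun b => ⟨fun y => ‖b y‖ ^ 2, by fun_prop⟩
  have hui : ∀ k, Integrable (u k) (ρ k : Measure Y) := fun k => (hu k).integrable one_le_two
  have hinner : ∀ (b : C(Y, W)) k,
      Integrable (fun y => inner ℝ (b y) (u k y)) (ρ k : Measure Y) := fun b k => by
    refine ((hui k).norm.const_mul ‖b‖).mono'
      ((b.continuous.stronglyMeasurable_of_hasCompactSupport
        (.of_compactSpace _)).aestronglyMeasurable.inner (hui k).1)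
      (ae_of_all _ fun p => (norm_inner_le_norm _ _).trans ?_)
    exact mul_le_mul_of_nonneg_right (b.norm_coe_le_norm p) (norm_nonneg _)
  have hyoung : ∀ (b : C(Y, W)) k, ∫ y, inner ℝ (b y) (u k y) ∂(ρ k : Measure Y)
      ≤ (∫ y, ‖b y‖ ^ 2 ∂(ρ k : Measure Y)) / 2 + e k := fun b k => by
    have h1 : ∫ y, inner ℝ (b y) (u k y) ∂(ρ k : Measure Y)
        ≤ ∫ y, (‖b y‖ ^ 2 / 2 + ‖u k y‖ ^ 2 / 2) ∂(ρ k : Measure Y) := by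
      refine integral_mono (hinner b k) (((hbi _ (nsq b)).div_const 2).add
        (((hu k).integrable_norm_pow two_ne_zero).div_const 2)) fun y => ?_
      have := real_inner_le_norm (b y) (u k y)
      simp only
      nlinarith [sq_nonneg (‖b y‖ - ‖u k y‖)]
    rw [integral_add (f := fun y => ‖b y‖ ^ 2 / 2) ((hbi _ (nsq b)).div_const 2)
      (((hu k).integrable_norm_pow two_ne_zero).div_const 2), integral_div, integral_div] at h1
    linarith [hE k]
  have hex : ∀ b : C(Y, W), ∃ L : ℝ,
      Tendsto (fun k => ∫ y, inner ℝ (b y) (u k y) ∂(ρ k : Measure Y)) l (𝓝 L) := fun b => by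
    have hlim : Tendsto (fun k => (∫ y, ‖b y‖ ^ 2 ∂(ρ k : Measure Y)) / 2 + e k) l
        (𝓝 ((∫ y, ‖b y‖ ^ 2 ∂(ρ' : Measure Y)) / 2 + m)) :=
      ((hφ (nsq b)).div_const 2).add (he.mono_left hl)
    set B := (∫ y, ‖b y‖ ^ 2 ∂(ρ' : Measure Y)) / 2 + m
    -- Young's inequality for `b` and for `-b` bounds the pairing on both sides.
    have hev : ∀ᶠ k in (l : Filter ℕ),
        ∫ y, inner ℝ (b y) (u k y) ∂(ρ k : Measure Y) ∈ Set.Icc (-(B + 1)) (B + 1) := by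
      filter_upwards [hlim.eventually (gt_mem_nhds (lt_add_one B))] with k hk
      have h1 := hyoung b k
      have h2 := hyoung (-b) k
      simp only [ContinuousMap.neg_apply, inner_neg_left, integral_neg, norm_neg] at h2
      exact ⟨by linarith, by linarith⟩
    obtain ⟨L, -, hL⟩ := isCompact_Icc.ultrafilter_le_nhds'
      (l.map fun k => ∫ y, inner ℝ (b y) (u k y) ∂(ρ k : Measure Y)) (Ultrafilter.mem_map.2 hev)
    exact ⟨L, hL⟩
  choose L hL using hex
  let Λ : C(Y, W) →ₗ[ℝ] ℝ :=
    { toFun := L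
      map_add' := fun b c => tendsto_nhds_unique (hL (b + c)) <| by
        refine ((hL b).add (hL c)).congr fun k => ?_
        rw [← integral_add (hinner b k) (hinner c k)]
        simp [inner_add_left]
      map_smul' := fun s b => tendsto_nhds_unique (hL (s • b)) <| by
        refine ((hL b).const_mul s).congr fun k => ?_
        rw [← integral_const_mul]
        simp [inner_smul_left] }
  obtain ⟨u', hu'm, hu', hu'E, hΛ⟩ := exists_field_of_quadratic_bound (ρ' : Measure Y) Λ
    (m := m) fun b => le_of_tendsto_of_tendsto' (hL b)
      (((hφ (nsq b)).div_const 2).add (he.mono_left hl)) (hyoung b)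
  exact ⟨l, ρ', u', inferInstance, hu'm, hu', hu'E, hφ, fun b => hΛ b ▸ hL b⟩

end Compactness

/-! ### Weak form of the constraints and existence of minimizers -/

/-- The hypothesis says that the time marginal is at most `C` times Lebesgue measure. As a family of
inequalities between integrals of continuous functions, it is inherited by weak limits. -/
theorem fst_absolutelyContinuous_of_integral_time_le {ρ : FiniteMeasure (I × Ω)} {C : NNReal}
    (h : ∀ ψ : C(I, ℝ), (∀ t, 0 ≤ ψ t) →
      ∫ p, ψ p.1 ∂(ρ : Measure (I × Ω)) ≤ C * ∫ t : I, ψ t) :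
    (ρ : Measure (I × Ω)).fst ≪ volume := by
  refine Measure.absolutelyContinuous_of_le_smul (c := (C : ℝ≥0∞)) ?_
  have hfin : IsFiniteMeasure ((C : ℝ≥0∞) • (volume : Measure I)) :=
    Measure.smul_finite _ ENNReal.coe_ne_top
  refine measure_le_of_forall_integral_continuous_le _ _ fun ψ hψ => ?_
  rw [Measure.fst, integral_map measurable_fst.aemeasurable
    ψ.continuous.measurable.aestronglyMeasurable, integral_smul_measure]
  exact h ψ hψ

theorem ofVelocity_mem_AffIneq_iff [CompactSpace Ω] [Nonempty Ω] {δ : ℝ}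
    {ρ : FiniteMeasure (I × Ω)} (hρ : (ρ : Measure (I × Ω)).fst ≪ volume) {u : I × Ω → Vel n}
    (hum : Measurable u) (hu : Integrable u (ρ : Measure (I × Ω)))
    {h : I × Ω → ℝ × EuclideanSpace ℝ (Fin n) × ℝ} (hh : Continuous h) {F : I → ℝ}
    (hF : Continuous F) :
    ofVelocity δ ρ u ∈ AffIneq h F ↔ ∀ ψ : C(I, ℝ), (∀ t, 0 ≤ ψ t) →
      ∫ p, ψ p.1 * constraintDensity δ h u p ∂(ρ : Measure (I × Ω)) ≤ ∫ t, ψ t * F t := by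
  obtain ⟨S, hS, hR, hψS⟩ := exists_slice_function δ hρ hum hu hh
  have hFi : Integrable F := hF.integrable_of_hasCompactSupport (.of_compactSpace _)
  rw [AffIneq, hR]
  simp_rw [← hψS]
  refine ⟨fun hle ψ hψ => ?_, fun hle => ae_le_of_forall_integral_continuous_mul_le hS hFi hle⟩
  have hbdd : ∀ {v : I → ℝ}, Integrable v → Integrable fun t => ψ t * v t :=
    fun hv => hv.bdd_mul (c := ‖ψ‖) ψ.continuous.measurable.aestronglyMeasurable
      (ae_of_all _ ψ.norm_coe_le_norm)
  exact integral_mono_ae (hbdd hS) (hbdd hFi)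
    (hle.mono fun t ht => mul_le_mul_of_nonneg_left ht (hψ t))

theorem ofVelocity_mem_AffEq_iff [CompactSpace Ω] [Nonempty Ω] {δ : ℝ}
    {ρ : FiniteMeasure (I × Ω)} (hρ : (ρ : Measure (I × Ω)).fst ≪ volume) {u : I × Ω → Vel n}
    (hum : Measurable u) (hu : Integrable u (ρ : Measure (I × Ω)))
    {h : I × Ω → ℝ × EuclideanSpace ℝ (Fin n) × ℝ} (hh : Continuous h) {F : I → ℝ}
    (hF : Continuous F) :
    ofVelocity δ ρ u ∈ AffEq h F ↔ ∀ ψ : C(I, ℝ),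
      ∫ p, ψ p.1 * constraintDensity δ h u p ∂(ρ : Measure (I × Ω)) = ∫ t, ψ t * F t := by
  obtain ⟨S, hS, hR, hψS⟩ := exists_slice_function δ hρ hum hu hh
  have hFi : Integrable F := hF.integrable_of_hasCompactSupport (.of_compactSpace _)
  rw [AffEq, hR]
  simp_rw [← hψS]
  refine ⟨fun heq ψ => integral_congr_ae (heq.mono fun t ht => by simp only [ht]), fun heq => ?_⟩
  filter_upwards [ae_le_of_forall_integral_continuous_mul_le hS hFi fun ψ _ => (heq ψ).le,
    ae_le_of_forall_integral_continuous_mul_le hFi hS fun ψ _ => (heq ψ).ge] with t h1 h2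
  exact le_antisymm h1 h2

theorem integral_mul_constraintDensity [CompactSpace Ω] (δ : ℝ) {ρ : FiniteMeasure (I × Ω)}
    {u : I × Ω → Vel n} (hu : Integrable u (ρ : Measure (I × Ω)))
    {h : I × Ω → ℝ × EuclideanSpace ℝ (Fin n) × ℝ} (hh : Continuous h) (ψ : C(I, ℝ)) :
    ∫ p, ψ p.1 * constraintDensity δ h u p ∂(ρ : Measure (I × Ω))
      = (∫ p, ψ p.1 * (h p).1 ∂(ρ : Measure (I × Ω)))
        + ∫ p, inner ℝ (ψ p.1 • velTest δ (h p).2.1 (h p).2.2) (u p) ∂(ρ : Measure (I × Ω)) := by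
  have hψ : Continuous fun p : I × Ω => ψ p.1 := by fun_prop
  have h1 : Integrable (fun p => ψ p.1 * (h p).1) (ρ : Measure (I × Ω)) :=
    (hψ.mul hh.fst).integrable_of_hasCompactSupport (.of_compactSpace _)
  have h2 := integrable_inner_continuous (b := fun p => ψ p.1 • velTest δ (h p).2.1 (h p).2.2) hu
    (hψ.smul ((continuous_velTest δ).comp hh.snd))
  rw [← integral_add h1 h2]
  refine integral_congr_ae (ae_of_all _ fun p => ?_)
  simp only [constraintDensity, real_inner_smul_left]
  ring

/-- Conditional kernels need a nonempty `Ω`. This settles the degenerate case, where a feasible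
triple is trivially optimal. -/
instance [IsEmpty Ω] : Subsingleton (MeasTriple n Ω) := by
  refine ⟨fun ⟨ρ, ω, ζ⟩ ⟨ρ', ω', ζ'⟩ => ?_⟩
  have h1 : ρ = ρ' := FiniteMeasure.toMeasure_injective (Subsingleton.elim _ _)
  have h2 : ω = ω' := funext fun j => by
    rw [VectorMeasure.eq_zero_of_isEmpty (ω j), VectorMeasure.eq_zero_of_isEmpty (ω' j)]
  have h3 : ζ = ζ' := by
    rw [VectorMeasure.eq_zero_of_isEmpty ζ, VectorMeasure.eq_zero_of_isEmpty ζ']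
  rw [h1, h2, h3]

theorem exists_minimizer [CompactSpace Ω] [Nonempty Ω] {d d' : ℕ} {δ : ℝ} (hδ : 0 < δ)
    (ρ₀ ρ₁ : FiniteMeasure Ω) {H : I × Ω → Fin d → ℝ × EuclideanSpace ℝ (Fin n) × ℝ}
    (hH : Continuous H) {F : I → Fin d → ℝ} (hF : Continuous F)
    (hfin : wfrSq δ d' H F ρ₀ ρ₁ < ⊤) :
    ∃ μ ∈ constrainedPaths d' H F ρ₀ ρ₁, energy δ μ = wfrSq δ d' H F ρ₀ ρ₁ := by
  set m : ℝ := (wfrSq δ d' H F ρ₀ ρ₁).toReal with hm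
  have hm' : wfrSq δ d' H F ρ₀ ρ₁ = ENNReal.ofReal m := (ENNReal.ofReal_toReal hfin.ne).symm
  have hm0 : 0 ≤ m := ENNReal.toReal_nonneg
  let e : ℕ → ℝ := fun k => m + 1 / ((k : ℝ) + 1)
  have he : Tendsto e atTop (𝓝 m) := by
    simpa [e] using (tendsto_const_nhds (x := m)).add
      (tendsto_one_div_add_atTop_nhds_zero_nat (𝕜 := ℝ))
  have he0 : ∀ k : ℕ, 0 < 1 / ((k : ℝ) + 1) := fun k => by positivity
  have he1 : ∀ k, e k ≤ m + 1 := fun k => by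
    have : 1 / ((k : ℝ) + 1) ≤ 1 := by
      rw [div_le_one (by positivity)]; linarith [k.cast_nonneg (α := ℝ)]
    simp only [e]; linarith
  have hseq : ∀ k, ∃ (ρ : FiniteMeasure (I × Ω)) (u : I × Ω → Vel n), Measurable u ∧
      MemLp u 2 (ρ : Measure (I × Ω)) ∧ ofVelocity δ ρ u ∈ constrainedPaths d' H F ρ₀ ρ₁ ∧
      ∫ p, ‖u p‖ ^ 2 ∂(ρ : Measure (I × Ω)) ≤ 2 * e k := fun k => by
    have hlt : wfrSq δ d' H F ρ₀ ρ₁ < ENNReal.ofReal (e k) := by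
      rw [hm']
      exact (ENNReal.ofReal_lt_ofReal_iff (by linarith [he0 k])).2 (by linarith [he0 k])
    rw [wfrSq] at hlt
    simp only [iInf_lt_iff] at hlt
    obtain ⟨μ, hμ, hμe⟩ := hlt
    obtain ⟨u, hum, hu, heq⟩ := exists_velocity_of_energy_lt_top hδ μ
      (hμe.trans ENNReal.ofReal_lt_top)
    refine ⟨μ.rho, u, hum, hu, heq ▸ hμ, ?_⟩
    rw [heq, energy_ofVelocity_eq_ofReal hδ _ hu] at hμe
    have := (ENNReal.ofReal_lt_ofReal_iff_of_nonneg
      (div_nonneg (integral_nonneg fun p => by positivity) two_pos.le)).1 hμe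
    linarith
  choose ρ u hum hu hpath hE using hseq
  -- The bound of `mass_le` at energy level `m + 1`, which dominates every `e k`.
  let C : NNReal :=
    (2 * (ρ₁ : Measure Ω).real Set.univ + 2 * (δ⁻¹ ^ 2 * (m + 1))).toNNReal
  have hC : (C : ℝ) = 2 * (ρ₁ : Measure Ω).real Set.univ + 2 * (δ⁻¹ ^ 2 * (m + 1)) :=
    Real.coe_toNNReal _ (by positivity)
  have hE1 : ∀ k, ∫ p, ‖u k p‖ ^ 2 ∂(ρ k : Measure (I × Ω)) ≤ 2 * (m + 1) := fun k =>
    (hE k).trans (by linarith [he1 k])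
  have hmass : ∀ k, (ρ k).mass ≤ C := fun k => by
    rw [← NNReal.coe_le_coe, hC]
    exact mass_le hδ (hu k) (hpath k).1 (hE1 k)
  have htime : ∀ k (ψ : C(I, ℝ)), (∀ t, 0 ≤ ψ t) →
      ∫ p, ψ p.1 ∂(ρ k : Measure (I × Ω)) ≤ C * ∫ t : I, ψ t := fun k ψ hψ => by
    rw [hC]
    exact integral_time_le_bound hδ (hu k) (hpath k).1 (hE1 k) ψ hψ
  obtain ⟨l, ρ', u', hl, hum', hu', hE', hφ, hb⟩ := exists_weak_limit hu hmass he hE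
  have hui := fun k => (hu k).integrable one_le_two
  have hui' := hu'.integrable one_le_two
  have hac := fun k => fst_absolutelyContinuous_of_integral_time_le (htime k)
  have hac' : (ρ' : Measure (I × Ω)).fst ≪ volume :=
    fst_absolutelyContinuous_of_integral_time_le (C := C) fun ψ hψ =>
      le_of_tendsto' (hφ ⟨fun p => ψ p.1, by fun_prop⟩) fun k => htime k ψ hψ
  have hHi : ∀ i, Continuous fun p => H p i := fun i => (continuous_apply i).comp hH
  have hFi : ∀ i, Continuous fun t => F t i := fun i => (continuous_apply i).comp hF
  have hconstr : ∀ i (ψ : C(I, ℝ)), Tendsto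
      (fun k => ∫ p, ψ p.1 * constraintDensity δ (fun p => H p i) (u k) p
        ∂(ρ k : Measure (I × Ω))) l
      (𝓝 (∫ p, ψ p.1 * constraintDensity δ (fun p => H p i) u' p
        ∂(ρ' : Measure (I × Ω)))) := fun i ψ => by
    have hψ : Continuous fun p : I × Ω => ψ p.1 := by fun_prop
    simp_rw [fun k => integral_mul_constraintDensity δ (hui k) (hHi i) ψ,
      integral_mul_constraintDensity δ hui' (hHi i) ψ]
    exact (hφ ⟨_, hψ.mul (hHi i).fst⟩).add
      (hb ⟨_, hψ.smul ((continuous_velTest δ).comp (hHi i).snd)⟩)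
  have hmem : ofVelocity δ ρ' u' ∈ constrainedPaths d' H F ρ₀ ρ₁ := by
    refine ⟨?_, fun i hi => ?_, fun i hi => ?_⟩
    · rw [ofVelocity_mem_CE_iff hui']
      intro φ hφ1
      have hc := hφ1.continuous
      have hlim := (hφ ⟨_, continuous_partial_deriv hφ1⟩).add
        (hb ⟨_, (continuous_velTest δ).comp ((continuous_partial_gradient hφ1).prodMk
          (g := fun p : I × Ω => φ (p.1, p.2)) (by fun_prop))⟩)
      refine tendsto_nhds_unique hlim (tendsto_const_nhds.congr fun k => ?_)
      exact ((ofVelocity_mem_CE_iff (hui k) ρ₀ ρ₁).1 (hpath k).1 φ hφ1).symm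
    · rw [ofVelocity_mem_AffIneq_iff hac' hum'.measurable hui' (hHi i) (hFi i)]
      exact fun ψ hψ => le_of_tendsto' (hconstr i ψ) fun k =>
        (ofVelocity_mem_AffIneq_iff (hac k) (hum k) (hui k) (hHi i) (hFi i)).1
          ((hpath k).2.1 i hi) ψ hψ
    · rw [ofVelocity_mem_AffEq_iff hac' hum'.measurable hui' (hHi i) (hFi i)]
      exact fun ψ => tendsto_nhds_unique (hconstr i ψ) (tendsto_const_nhds.congr fun k =>
        ((ofVelocity_mem_AffEq_iff (hac k) (hum k) (hui k) (hHi i) (hFi i)).1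
          ((hpath k).2.2 i hi) ψ).symm)
  refine ⟨_, hmem, le_antisymm ?_ (iInf₂_le _ hmem)⟩
  rw [energy_ofVelocity_eq_ofReal hδ ρ' hu', hm']
  exact ENNReal.ofReal_le_ofReal (by linarith)

end ConstrainedWFR

end

theorem theorem3p3 {n d d' : ℕ} (hd : d' ≤ d)
    (Ω : Set (EuclideanSpace ℝ (Fin n))) (hΩ : IsCompact Ω)
    (δ : ℝ) (hδ : 0 < δ) (ρ₀ ρ₁ : FiniteMeasure Ω)
    (H : I × Ω → Fin d → ℝ × EuclideanSpace ℝ (Fin n) × ℝ) (hH : Continuous H)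
    (F : I → Fin d → ℝ) (hF : Continuous F)
    (hfeas : ∃ μ ∈ ConstrainedWFR.constrainedPaths d' H F ρ₀ ρ₁,
      ConstrainedWFR.energy δ μ < ⊤) :
    ∃ μ ∈ ConstrainedWFR.constrainedPaths d' H F ρ₀ ρ₁,
      ConstrainedWFR.energy δ μ = ConstrainedWFR.wfrSq δ d' H F ρ₀ ρ₁ := by
  obtain ⟨μ, hμ, hE⟩ := hfeas
  have : CompactSpace Ω := isCompact_iff_compactSpace.1 hΩ
  rcases isEmpty_or_nonempty Ω with hempty | hne
  · refine ⟨μ, hμ, le_antisymm (le_iInf₂ fun ν _ => ?_) (iInf₂_le _ hμ)⟩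
    rw [Subsingleton.elim ν μ]
  · exact ConstrainedWFR.exists_minimizer hδ ρ₀ ρ₁ hH hF ((iInf₂_le _ hμ).trans_lt hE)
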